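/- **Theorem 2.1.** Let $N\ge 1$ be an integer, $R>0$, $\mu\ge 0$ and $\nu\in\mathbb R$ with $N+\mu>1$ and $\delta:=(\mu-1)^2-4\nu^2\ge 0$. For real $d>1$ put $$p_G(d)=1+\frac{2}{d-1},\qquad q_S(d)=\frac{d+1+\sqrt{d^2+10d-7}}{2(d-1)},\qquad \lambda(p,q,d)=(q-1)\big((d-1)p-2\big).$$ Let $p,q>1$ satisfy $p>p_G(N+\mu)$, $q>q_S(N+\mu)$ and $\lambda(p,q,N+\mu)<4$. Let $f\in H^1(\mathbb R^N)$ and $g\in L^2(\mathbb R^N)$ be non-negative functions supported in the ball $B(0,R)$, not both zero almost everywhere, such that $$\frac{\mu-1-\sqrt\delta}{2}\,f(x)+g(x)>0\qquad\text{for almost every }x\text{ with }(f(x),g(x))\ne(0,0).$$ For $\varepsilon>0$ consider the Cauchy problem $$u_{tt}-\Delta u+\frac{\mu}{1+t}u_t+\frac{\nu^2}{(1+t)^2}u=|u_t|^p+|u|^q,\qquad u(\cdot,0)=\varepsilon f,\quad u_t(\cdot,0)=\varepsilon g. \tag{1}$$ An energy solution of (1) on $[0,T)$, $T\in(0,\infty]$,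 is a function $u\in C([0,T),H^1(\mathbb R^N))\cap C^1([0,T),L^2(\mathbb R^N))$ with $u\in L^q_{loc}((0,T)\times\mathbb R^N)$ and $u_t\in L^p_{loc}((0,T)\times\mathbb R^N)$, which takes the initial data in (1) and satisfies, for all $\Phi\in C_0^\infty(\mathbb R^N\times[0,T))$ and all $t\in[0,T)$, $$\begin{aligned}&\int_{\mathbb R^N}u_t(x,t)\Phi(x,t)\,dx-\int_{\mathbb R^N}u_t(x,0)\Phi(x,0)\,dx-\int_0^t\!\!\int_{\mathbb R^N}u_t\Phi_t\,dx\,ds+\int_0^t\!\!\int_{\mathbb R^N}\nabla u\cdot\nabla\Phi\,dx\,ds\\&\quad+\int_0^t\!\!\int_{\mathbb R^N}\frac{\mu}{1+s}u_t\Phi\,dx\,ds+\int_0^t\!\!\int_{\mathbb R^N}\frac{\nu^2}{(1+s)^2}u\,\Phi\,dx\,ds=\int_0^t\!\!\int_{\mathbb R^N}\big(|u_t|^p+|u|^q\big)\Phi\,dx\,ds,\end{aligned}$$ where the integral on the right is required to converge. Then there are constants $\varepsilon_0>0$ and $C>0$, depending only on $f,g,N,R,p,q,\mu,\nu$, such that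 for every $\varepsilon\in(0,\varepsilon_0]$, every $T_\varepsilon\in(0,\infty]$ and every energy solution $u$ of (1) on $[0,T_\varepsilon)$ with $\operatorname{supp}u\subset\{(x,t):|x|\le t+R\}$, $$T_\varepsilon\le C\,\varepsilon^{-\frac{2p(q-1)}{4-\lambda(p,q,N+\mu)}} .$$ In particular no such solution is global, and the exponent of $\varepsilon$ does not depend on $\nu$. -/

import Mathlib

open MeasureTheory Set
open scoped ContDiff Gradient

noncomputable section

namespace WaveBlowup

/-- The Glassey exponent as a function of a real dimension `d` (meaningful for `d > 1`). -/
def pG (d : ℝ) : ℝ := 1 + 2 / (d - 1)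

/-- The Strauss exponent as a function of a real dimension `d` (meaningful for `d > 1`). -/
def qS (d : ℝ) : ℝ := (d + 1 + Real.sqrt (d ^ 2 + 10 * d - 7)) / (2 * (d - 1))

/-- The exponent `λ(p, q, d)` of the combined nonlinearity. -/
def lam (p q d : ℝ) : ℝ := (q - 1) * ((d - 1) * p - 2)

/-- The discriminant `δ` of the scale-invariant damping and mass. -/
def delta (μ ν : ℝ) : ℝ := (μ - 1) ^ 2 - 4 * ν ^ 2

/-- The space `ℝ^N` with its Euclidean norm. -/
abbrev Space (N : ℕ) : Type := EuclideanSpace ℝ (Fin N)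

/-- The Hilbert space `L²(ℝ^N)` of real-valued functions. -/
abbrev LTwo (N : ℕ) : Type := Lp ℝ 2 (volume : Measure (Space N))

/-- The Hilbert space `L²(ℝ^N; ℝ^N)` of vector fields. -/
abbrev LTwoVec (N : ℕ) : Type := Lp (Space N) 2 (volume : Measure (Space N))

/-- `w` is the weak (distributional) gradient of `v` on `ℝ^N`. It is used only for square-integrable
`v` and `w`, so that both integrals converge absolutely. -/
def HasWeakGradient {N : ℕ} (v : Space N → ℝ) (w : Space N → Space N) : Prop :=
  ∀ φ : Space N → ℝ, ContDiff ℝ ∞ φ → HasCompactSupport φ →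
    ∫ x, v x • ∇ φ x = - ∫ x, φ x • w x

/-- The Sobolev space `H¹(ℝ^N)`. -/
def MemHOne {N : ℕ} (v : Space N → ℝ) : Prop :=
  MemLp v 2 volume ∧ ∃ w : Space N → Space N, MemLp w 2 volume ∧ HasWeakGradient v w

/-- The time interval `[0, T)`, where `T` may be infinite. -/
def timeInterval (T : EReal) : Set ℝ := {t : ℝ | 0 ≤ t ∧ (t : EReal) < T}

/-- Test functions `Φ ∈ C₀^∞(ℝ^N × [0, T))`: smooth up to the time `t = 0` (they are restrictions of
smooth compactly supported functions on `ℝ^N × ℝ`), with compact support avoiding `t ≥ T`.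
They need not vanish at `t = 0`. -/
def IsTestFunction {N : ℕ} (T : EReal) (Φ : Space N → ℝ → ℝ) : Prop :=
  ContDiff ℝ ∞ (fun z : Space N × ℝ => Φ z.1 z.2) ∧
  HasCompactSupport (fun z : Space N × ℝ => Φ z.1 z.2) ∧
  ∀ z ∈ tsupport (fun z : Space N × ℝ => Φ z.1 z.2), (z.2 : EReal) < T

/-- `v ∈ L^r_loc((0, T) × ℝ^N)`, for a curve `v` in `L²(ℝ^N)`: the space-time integral of `|v|^r` over
every compact cylinder `[a, b] × {|x| ≤ ρ}` with `0 < a` and `b < T` is finite. Every compact subset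
of `(0, T) × ℝ^N` lies in such a cylinder. -/
def MemLpLoc {N : ℕ} (r : ℝ) (T : EReal) (v : ℝ → LTwo N) : Prop :=
  ∀ a b ρ : ℝ, 0 < a → (b : EReal) < T →
    ∫⁻ s in Icc a b, ∫⁻ x in Metric.closedBall (0 : Space N) ρ, ENNReal.ofReal (|v s x| ^ r) < ⊤

/-- `u`, with time derivative `ut` and spatial gradient `Du`, is an energy (weak) solution on `[0, T)` of
`u_tt - Δu + μ/(1+t) u_t + ν²/(1+t)² u = |u_t|^p + |u|^q`, `u(0) = ε f`, `u_t(0) = ε g`.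
The functions `ut` and `Du` are determined by `u` on `[0, T)`. -/
structure IsEnergySolution {N : ℕ} (μ ν p q ε : ℝ) (f g : Space N → ℝ) (T : EReal)
    (u ut : ℝ → LTwo N) (Du : ℝ → LTwoVec N) : Prop where
  /-- `u ∈ C([0, T), H¹)`: `u` and its weak gradient are continuous with values in `L²`. -/
  continuousOn_u : ContinuousOn u (timeInterval T)
  hasWeakGradient : ∀ t ∈ timeInterval T, HasWeakGradient (u t) (Du t)
  continuousOn_Du : ContinuousOn Du (timeInterval T)
  /-- `u ∈ C¹([0, T), L²)` with derivative `ut` (one-sided at `t = 0`). -/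
  hasDerivWithinAt : ∀ t ∈ timeInterval T, HasDerivWithinAt u (ut t) (timeInterval T) t
  continuousOn_ut : ContinuousOn ut (timeInterval T)
  memLpLoc_u : MemLpLoc q T u
  memLpLoc_ut : MemLpLoc p T ut
  initial_u : ∀ᵐ x, u 0 x = ε * f x
  initial_ut : ∀ᵐ x, ut 0 x = ε * g x
  /-- The integral of the nonlinearity in the weak formulation converges (down to the time `0`). -/
  integrable_nonlinearity : ∀ Φ : Space N → ℝ → ℝ, IsTestFunction T Φ → ∀ t ∈ timeInterval T,
    IntervalIntegrable (fun s => ∫ x, (|ut s x| ^ p + |u s x| ^ q) * Φ x s) volume 0 t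
  /-- The weak formulation. -/
  weak_form : ∀ Φ : Space N → ℝ → ℝ, IsTestFunction T Φ → ∀ t ∈ timeInterval T,
    (∫ x, ut t x * Φ x t) - (∫ x, ut 0 x * Φ x 0)
      - (∫ s in (0 : ℝ)..t, ∫ x, ut s x * deriv (fun τ => Φ x τ) s)
      + (∫ s in (0 : ℝ)..t, ∫ x, inner ℝ (Du s x) (∇ (fun y => Φ y s) x))
      + (∫ s in (0 : ℝ)..t, ∫ x, μ / (1 + s) * ut s x * Φ x s)
      + (∫ s in (0 : ℝ)..t, ∫ x, ν ^ 2 / (1 + s) ^ 2 * u s x * Φ x s)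
    = ∫ s in (0 : ℝ)..t, ∫ x, (|ut s x| ^ p + |u s x| ^ q) * Φ x s

end WaveBlowup

end

open WaveBlowup

namespace WaveBlowup

/-! Integrating the equation over space, the mean U(t) = ∫ u solves the Euler-type equation U'' +
μ/(1+t) U' + ν²/(1+t)² U = n, where n = ∫ (|u_t|^p + |u|^q). Put d = √δ and let r = (1 - μ + d)/2 be
the larger characteristic exponent. Then H = (1+t)^(-r) U satisfies ((1+t)^(1+d) H')' =
(1+t)^(1+d-r) n ≥ 0 (`IsEnergySolution.mean_identity`). The sign condition on the data says
precisely that H starts with nonnegative slope, so H is nonnegative and nondecreasing.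

Two lower bounds for n drive the blow-up. Hölder's inequality on the ball |x| ≤ t + R gives n ≥ c
(1+t)^(-N(q-1)) |U|^q (`exists_sourceMoment_ge_moment`). For the other one, test with a positive
radial solution φ of Δφ = η²φ, where η is so large that the mass term is harmless. A comparison
argument (`exists_exponential_lower_bound`) shows that ∫ u_t φ is at least of order ε (1+t)^(-μ/2)
e^(ηt). Since φ(x) is at most of order (1+|x|)^(-(N-1)/2) e^(η|x|), Hölder's inequality on the light
cone cancels the exponentials and leaves n ≥ c ε^p (1+t)^σ with σ = N - 1 - (N-1+μ)p/2
(`exists_sourceMoment_ge_rpow`).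

On a window [S/2, 2S] every power of 1 + t is comparable to a power of S. Integrating the second
bound twice over [S/2, S] makes H(S) at least of order ε^p S^(σ+2-r). From S on, the first bound
makes H double along steps of geometrically decreasing length, which would force H to be unbounded
before 2S unless ε^(p(q-1)) S^((4-λ)/2) stays below a constant (`exists_blowup_bound`). In that
exponent r cancels, which is why ν does not enter the lifespan rate. Taking S to be a large multiple
of ε^(-2p(q-1)/(4-λ)) gives the contradiction. -/

/-! ### Power series of the radial eigenfunction. -/

/-- The Taylor coefficients of the entire function `y ↦ ∑ c_k y ^ k` for which `x ↦ ∑ c_k ‖x‖ ^ (2 k)` is the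
radial eigenfunction of the Laplacian on `ℝ ^ d` with eigenvalue `1`. -/
noncomputable def radialCoeff (d k : ℕ) : ℝ :=
  (∏ j ∈ Finset.range k, (2 * ((j : ℝ) + 1) * ((d : ℝ) + 2 * j)))⁻¹

/-- The profile of the radial eigenfunction of the Laplacian on `ℝ ^ d`, as a function of `‖x‖ ^ 2`. -/
noncomputable def radialProfile (d : ℕ) (y : ℝ) : ℝ := ∑' k, radialCoeff d k * y ^ k

lemma radialCoeff_zero (d : ℕ) : radialCoeff d 0 = 1 := by simp [radialCoeff]

lemma radialCoeff_pos {d : ℕ} (hd : 1 ≤ d) (k : ℕ) : 0 < radialCoeff d k := by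
  unfold radialCoeff
  have : (0 : ℝ) < d := by exact_mod_cast hd
  exact inv_pos.2 (Finset.prod_pos fun j _ => by positivity)

lemma radialCoeff_succ (d k : ℕ) :
    radialCoeff d (k + 1) = radialCoeff d k / (2 * ((k : ℝ) + 1) * ((d : ℝ) + 2 * k)) := by
  unfold radialCoeff
  rw [Finset.prod_range_succ, mul_inv, div_eq_mul_inv]

lemma radialCoeff_le_inv_factorial {d : ℕ} (hd : 1 ≤ d) (k : ℕ) :
    radialCoeff d k ≤ ((k.factorial : ℝ))⁻¹ := by
  have hd' : (1 : ℝ) ≤ d := by exact_mod_cast hd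
  induction k with
  | zero => simp [radialCoeff_zero]
  | succ k ih =>
    rw [radialCoeff_succ, Nat.factorial_succ, Nat.cast_mul, mul_inv, mul_comm (_ : ℝ)⁻¹, div_eq_mul_inv]
    refine mul_le_mul ih ?_ (by positivity) (by positivity)
    apply inv_anti₀ (by positivity)
    push_cast
    nlinarith [Nat.cast_nonneg (α := ℝ) k]

/-- Differentiating the profile in the variable y = ‖x‖² raises the dimension by two. This
coefficient identity is the source of the derivative formula, of smoothness and of the differential
equation. -/
lemma succ_mul_radialCoeff_succ {d : ℕ} (hd : 1 ≤ d) (k : ℕ) :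
    ((k : ℝ) + 1) * radialCoeff d (k + 1) = radialCoeff (d + 2) k / (2 * d) := by
  have hd' : (0 : ℝ) < d := by exact_mod_cast hd
  induction k with
  | zero => rw [radialCoeff_succ]; simp [radialCoeff_zero]
  | succ k ih =>
    rw [radialCoeff_succ d (k + 1), radialCoeff_succ (d + 2) k]
    have h : radialCoeff (d + 2) k = ((k : ℝ) + 1) * radialCoeff d (k + 1) * (2 * d) := by
      rw [ih]; field_simp
    rw [h]
    push_cast
    field_simp
    ring

lemma summable_radialCoeff_mul_pow {d : ℕ} (hd : 1 ≤ d) (y : ℝ) :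
    Summable fun k => radialCoeff d k * y ^ k := by
  refine Summable.of_norm_bounded (Real.summable_pow_div_factorial |y|) fun k => ?_
  rw [norm_mul, norm_pow, Real.norm_eq_abs, Real.norm_eq_abs, abs_of_pos (radialCoeff_pos hd k),
    div_eq_mul_inv, mul_comm]
  exact mul_le_mul_of_nonneg_left (radialCoeff_le_inv_factorial hd k) (by positivity)

lemma hasDerivAt_radialProfile {d : ℕ} (hd : 1 ≤ d) (y : ℝ) :
    HasDerivAt (radialProfile d) (radialProfile (d + 2) y / (2 * d)) y := by
  have key : ∀ M : ℝ, HasSum (fun n : ℕ => radialCoeff d n * (n * M ^ (n - 1)))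
      (radialProfile (d + 2) M / (2 * d)) := by
    intro M
    have h2 := (summable_radialCoeff_mul_pow (d := d + 2) (by omega) M).hasSum.div_const (2 * (d : ℝ))
    rw [← hasSum_nat_add_iff' 1]
    simp only [Finset.range_one, Finset.sum_singleton, Nat.cast_zero, zero_mul, mul_zero, sub_zero]
    refine h2.congr_fun ?_
    intro n
    have := succ_mul_radialCoeff_succ hd n
    simp only [Nat.add_sub_cancel]
    push_cast
    rw [mul_div_right_comm, ← this]; ring
  -- On the ball of radius |y| + 1 the differentiated terms are dominated by their values at |y| +
  -- 1, and that series is summable by `key`.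
  have h := hasDerivAt_tsum_of_isPreconnected (𝕜 := ℝ) (F := ℝ)
    (u := fun n : ℕ => radialCoeff d n * (n * (|y| + 1) ^ (n - 1)))
    (g := fun n y => radialCoeff d n * y ^ n) (g' := fun n y => radialCoeff d n * (n * y ^ (n - 1)))
    (t := Metric.ball 0 (|y| + 1)) (y₀ := 0) (y := y) (key _).summable Metric.isOpen_ball
    (convex_ball _ _).isPreconnected (fun n z _ => (hasDerivAt_pow n z).const_mul _)
    (fun n z hz => ?_) (by simp; positivity) (summable_radialCoeff_mul_pow hd 0) (by simp)
  · rw [(key y).tsum_eq] at h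
    exact h
  · have hz' : |z| ≤ |y| + 1 := by
      rw [Metric.mem_ball, dist_zero_right, Real.norm_eq_abs] at hz; exact hz.le
    rw [norm_mul, norm_mul, norm_pow, Real.norm_eq_abs, Real.norm_eq_abs, Real.norm_eq_abs,
      abs_of_pos (radialCoeff_pos hd n), Nat.abs_cast]
    gcongr
    exact (radialCoeff_pos hd n).le

/-- Each derivative is again a profile, in dimension d + 2, so the induction on the order runs over
all dimensions at once. -/
lemma contDiff_radialProfile {d : ℕ} (hd : 1 ≤ d) : ContDiff ℝ ∞ (radialProfile d) := by
  rw [contDiff_infty]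
  intro n
  induction n generalizing d with
  | zero =>
    exact contDiff_zero.2 (continuous_iff_continuousAt.2 fun y =>
      (hasDerivAt_radialProfile hd y).continuousAt)
  | succ n ih =>
    rw [show ((n + 1 : ℕ) : WithTop ℕ∞) = (n : WithTop ℕ∞) + 1 from by push_cast; rfl,
      contDiff_succ_iff_deriv]
    refine ⟨fun y => (hasDerivAt_radialProfile hd y).differentiableAt, by simp, ?_⟩
    rw [show deriv (radialProfile d) = fun y => radialProfile (d + 2) y / (2 * d) from
      funext fun y => (hasDerivAt_radialProfile hd y).deriv]
    exact (ih (by omega)).div_const _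

/-- The second-order differential equation of the radial profile, in terms of the recursion for its derivatives. -/
lemma radialProfile_ode {d : ℕ} (hd : 1 ≤ d) (y : ℝ) :
    y * radialProfile (d + 4) y / (d * (d + 2)) + radialProfile (d + 2) y = radialProfile d y := by
  have hd' : (0 : ℝ) < d := by exact_mod_cast hd
  have h4 := (summable_radialCoeff_mul_pow (d := d + 4) (by omega) y).hasSum
  have h2 := (summable_radialCoeff_mul_pow (d := d + 2) (by omega) y).hasSum
  have h0 := (summable_radialCoeff_mul_pow hd y).hasSum
  have h4' := (h4.mul_left y).div_const ((d : ℝ) * (d + 2))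
  rw [← hasSum_nat_add_iff' 1] at h2 h0
  have hs := h4'.add h2
  have := hs.unique (h0.congr_fun ?_)
  · simp only [Finset.range_one, Finset.sum_singleton, pow_zero, radialCoeff_zero] at this
    unfold radialProfile at *
    linarith
  · intro n
    have e1 := succ_mul_radialCoeff_succ (d := d + 2) (by omega) n
    have e2 := succ_mul_radialCoeff_succ hd (n + 1)
    have e3 := radialCoeff_succ d (n + 1)
    rw [e3] at e2
    have e4 : radialCoeff (d + 2) (n + 1) = radialCoeff d (n + 1) * (2 * d) / (2 * (d + 2 * (n + 1))) := by
      push_cast at e2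
      field_simp at e2 ⊢
      linarith
    have e5 : radialCoeff (d + 4) n = (n + 1) * radialCoeff (d + 2) (n + 1) * (2 * (d + 2)) := by
      rw [show d + 4 = d + 2 + 2 from rfl]
      push_cast at e1
      rw [e1]; field_simp
    rw [e5, e4]
    field_simp
    ring

lemma one_le_radialProfile {d : ℕ} (hd : 1 ≤ d) {y : ℝ} (hy : 0 ≤ y) : 1 ≤ radialProfile d y := by
  have h := (summable_radialCoeff_mul_pow hd y).le_tsum 0
    (fun k _ => mul_nonneg (radialCoeff_pos hd k).le (by positivity))
  rwa [pow_zero, mul_one, radialCoeff_zero] at h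

/-- Up to a constant, the coefficient is bounded by the geometric mean of 1/(2k)! and 1/(2k+d-1)!.
This yields the factor r^(-(d-1)/2) in the growth of the eigenfunction without any asymptotics of
Bessel functions. -/
lemma radialCoeff_sq_le {d : ℕ} (hd : 1 ≤ d) (k : ℕ) :
    radialCoeff d k ^ 2 ≤ ((d - 1).factorial : ℝ) /
      ((2 * k).factorial * (2 * k + (d - 1)).factorial) := by
  obtain ⟨m, rfl⟩ : ∃ m, d = m + 1 := ⟨d - 1, by omega⟩
  simp only [Nat.add_sub_cancel]
  induction k with
  | zero =>
    have : (m.factorial : ℝ) ≠ 0 := by positivity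
    simp [radialCoeff_zero, this]
  | succ k ih =>
    rw [radialCoeff_succ, div_pow, show 2 * (k + 1) = 2 * k + 1 + 1 by ring,
      show 2 * k + 1 + 1 + m = 2 * k + m + 1 + 1 by ring]
    simp only [Nat.factorial_succ]
    push_cast
    have hA : (0 : ℝ) < (2 * k).factorial := by positivity
    have hB : (0 : ℝ) < (2 * k + m).factorial := by positivity
    have hC : (0 : ℝ) < m.factorial := by positivity
    calc _ ≤ (m.factorial : ℝ) / ((2 * k).factorial * (2 * k + m).factorial) /
          (2 * ((k : ℝ) + 1) * (((m : ℝ) + 1) + 2 * k)) ^ 2 := by gcongr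
      _ ≤ _ := by
        rw [div_div]
        refine div_le_div_of_nonneg_left hC.le (by positivity) ?_
        have hk : (0 : ℝ) ≤ k := by positivity
        have hm : (0 : ℝ) ≤ m := by positivity
        have : (2 * (k : ℝ) + 1 + 1) * (2 * k + 1) * ((2 * k + m + 1 + 1) * (2 * k + m + 1)) ≤
            (2 * ((k : ℝ) + 1) * (((m : ℝ) + 1) + 2 * k)) ^ 2 := by
          -- The two sides differ by exactly m.
          have h1 : (2 * (k : ℝ) + 1) * (2 * k + m + 2) ≤ (2 * k + 2) * (2 * k + m + 1) := by nlinarith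
          have h2 : (0 : ℝ) ≤ (2 * k + 2) * (2 * k + m + 1) := by positivity
          nlinarith [mul_le_mul_of_nonneg_left h1 h2]
        calc _ = ((2 * k).factorial * (2 * k + m).factorial : ℝ) *
              ((2 * (k : ℝ) + 1 + 1) * (2 * k + 1) * ((2 * k + m + 1 + 1) * (2 * k + m + 1))) := by ring
          _ ≤ _ := by gcongr

lemma tsum_even_le_exp {r : ℝ} (hr : 0 ≤ r) (m : ℕ) :
    Summable (fun k : ℕ => r ^ (2 * k + m) / (2 * k + m).factorial) ∧
    ∑' k : ℕ, r ^ (2 * k + m) / (2 * k + m).factorial ≤ Real.exp r := by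
  have hs := Real.summable_pow_div_factorial r
  have hinj : Function.Injective fun k : ℕ => 2 * k + m := fun a b h => by simp at h; omega
  refine ⟨hs.comp_injective hinj, ?_⟩
  rw [Real.exp_eq_exp_ℝ, NormedSpace.exp_eq_tsum_div]
  exact tsum_comp_le_tsum_of_inj hs (fun n => by positivity) hinj

/-- The profile is bounded by `e ^ r / r ^ ((d - 1) / 2)` up to a constant. -/
lemma radialProfile_sq_le {d : ℕ} (hd : 1 ≤ d) {r : ℝ} (hr : 0 < r) :
    radialProfile d (r ^ 2) ≤ Real.sqrt ((d - 1).factorial) * (r ^ (-((d : ℝ) - 1) / 2) * Real.exp r) := by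
  obtain ⟨m, rfl⟩ : ∃ m, d = m + 1 := ⟨d - 1, by omega⟩
  simp only [Nat.add_sub_cancel]
  set θ : ℝ := r ^ (-((m : ℝ)) / 2) with hθ
  have hθ0 : 0 < θ := Real.rpow_pos_of_pos hr _
  have hθ2 : θ ^ 2 * r ^ m = 1 := by
    rw [hθ, ← Real.rpow_natCast, ← Real.rpow_mul hr.le, ← Real.rpow_natCast r m, ← Real.rpow_add hr]
    norm_num
  obtain ⟨s0, l0⟩ := tsum_even_le_exp hr.le 0
  obtain ⟨sm, lm⟩ := tsum_even_le_exp hr.le m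
  simp only [add_zero] at s0 l0
  set c := Real.sqrt (m.factorial : ℝ) with hc
  have hc0 : 0 ≤ c := Real.sqrt_nonneg _
  have hc2 : c ^ 2 = m.factorial := Real.sq_sqrt (by positivity)
  -- By the arithmetic-geometric mean inequality each term is split between two subseries of the
  -- exponential series, with exponents 2k and 2k + m. The factor θ = r^(-m/2) compensates the shift
  -- by m.
  have hterm : ∀ k : ℕ, radialCoeff (m + 1) k * (r ^ 2) ^ k ≤
      c * θ / 2 * (r ^ (2 * k) / (2 * k).factorial) +
        c * θ / 2 * (r ^ (2 * k + m) / (2 * k + m).factorial) := by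
    intro k
    set x := r ^ (2 * k) / ((2 * k).factorial : ℝ) with hx
    set y := r ^ (2 * k + m) / ((2 * k + m).factorial : ℝ) with hy
    have hx0 : 0 ≤ x := by positivity
    have hy0 : 0 ≤ y := by positivity
    have h1 := radialCoeff_sq_le (d := m + 1) (by omega) k
    simp only [Nat.add_sub_cancel] at h1
    refine le_of_sq_le_sq ?_ (by positivity)
    calc (radialCoeff (m + 1) k * (r ^ 2) ^ k) ^ 2
        = radialCoeff (m + 1) k ^ 2 * (r ^ (2 * k)) ^ 2 := by rw [mul_pow, ← pow_mul r 2 k]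
      _ ≤ (m.factorial : ℝ) / ((2 * k).factorial * (2 * k + m).factorial) * (r ^ (2 * k)) ^ 2 := by
        gcongr
      _ = (c * θ) ^ 2 * (x * y) := by
        have : (c * θ) ^ 2 * (x * y) = c ^ 2 * (θ ^ 2 * r ^ m) *
          (r ^ (2 * k)) ^ 2 / ((2 * k).factorial * (2 * k + m).factorial) := by
          rw [hx, hy, pow_add r (2 * k) m]; field_simp
        rw [this, hθ2, hc2]; ring
      _ ≤ (c * θ) ^ 2 * ((x + y) / 2) ^ 2 := by
        gcongr
        nlinarith [sq_nonneg (x - y)]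
      _ = _ := by ring
  have hle := Summable.tsum_le_tsum hterm (summable_radialCoeff_mul_pow (by omega) _)
    ((s0.mul_left _).add (sm.mul_left _))
  rw [Summable.tsum_add (s0.mul_left _) (sm.mul_left _), tsum_mul_left, tsum_mul_left] at hle
  have e : -(((m + 1 : ℕ) : ℝ) - 1) / 2 = -(m : ℝ) / 2 := by push_cast; ring
  rw [e]
  calc _ ≤ _ := hle
    _ ≤ c * θ / 2 * Real.exp r + c * θ / 2 * Real.exp r := by gcongr
    _ = _ := by ring

/-! ### Gradient, Laplacian and the radial eigenfunction on ℝ^N. -/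

variable {N : ℕ}

lemma gradient_apply (b : Space N → ℝ) (x : Space N) (i : Fin N) :
    (∇ b x) i = fderiv ℝ b x (EuclideanSpace.single i 1) := by
  rw [← inner_gradient_left, EuclideanSpace.inner_single_right]
  simp

/-- The Laplacian, as the sum of the second partial derivatives. -/
noncomputable def coordLaplacian (b : Space N → ℝ) (x : Space N) : ℝ :=
  ∑ i, (∇ (fun y => (∇ b y) i) x) i

lemma contDiff_gradient_apply {b : Space N → ℝ} (hb : ContDiff ℝ ∞ b) (i : Fin N) :
    ContDiff ℝ ∞ fun x => (∇ b x) i := by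
  simp_rw [gradient_apply]
  exact (hb.fderiv_right (by simp)).clm_apply contDiff_const

lemma hasCompactSupport_gradient_apply {b : Space N → ℝ} (hb : HasCompactSupport b) (i : Fin N) :
    HasCompactSupport fun x => (∇ b x) i := by
  simp_rw [gradient_apply]
  exact hb.fderiv_apply ℝ _

lemma contDiff_coordLaplacian {b : Space N → ℝ} (hb : ContDiff ℝ ∞ b) :
    ContDiff ℝ ∞ (coordLaplacian b) :=
  ContDiff.sum fun i _ => contDiff_gradient_apply (contDiff_gradient_apply hb i) i

lemma hasCompactSupport_coordLaplacian {b : Space N → ℝ} (hb : HasCompactSupport b) :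
    HasCompactSupport (coordLaplacian b) := by
  refine HasCompactSupport.intro hb.isCompact fun x hx => ?_
  refine Finset.sum_eq_zero fun i _ => ?_
  have : (fun y => (∇ b y) i) =ᶠ[nhds x] fun _ => 0 := by
    filter_upwards [(isClosed_tsupport b).isOpen_compl.mem_nhds hx] with y hy
    have : b =ᶠ[nhds y] fun _ => 0 := notMem_tsupport_iff_eventuallyEq.1 hy
    rw [this.gradient_eq, gradient_fun_const]
    rfl
  rw [this.gradient_eq, gradient_fun_const]
  rfl

lemma coordLaplacian_congr {b c : Space N → ℝ} {x : Space N} (h : b =ᶠ[nhds x] c) :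
    coordLaplacian b x = coordLaplacian c x := by
  refine Finset.sum_congr rfl fun i _ => ?_
  have h' : (fun y => (∇ b y) i) =ᶠ[nhds x] fun y => (∇ c y) i := by
    filter_upwards [h.gradient] with y hy
    rw [hy]
  rw [h'.gradient_eq]

/-- The radial eigenfunction of the Laplacian on `ℝ ^ N` with eigenvalue `η ^ 2`. -/
noncomputable def radialEigen (N : ℕ) (η : ℝ) (x : Space N) : ℝ :=
  radialProfile N (η ^ 2 * ‖x‖ ^ 2)

lemma contDiff_radialEigen (hN : 1 ≤ N) (η : ℝ) : ContDiff ℝ ∞ (radialEigen N η) :=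
  (contDiff_radialProfile hN).comp (contDiff_const.mul (contDiff_norm_sq ℝ))

lemma one_le_radialEigen (hN : 1 ≤ N) (η : ℝ) (x : Space N) : 1 ≤ radialEigen N η x :=
  one_le_radialProfile hN (by positivity)

lemma hasFDerivAt_radialProfile_norm_sq {d : ℕ} (hd : 1 ≤ d) (η : ℝ) (x : Space N) :
    HasFDerivAt (fun y : Space N => radialProfile d (η ^ 2 * ‖y‖ ^ 2))
      ((η ^ 2 / d * radialProfile (d + 2) (η ^ 2 * ‖x‖ ^ 2)) • innerSL ℝ x) x := by
  have h1 := ((hasFDerivAt_id x).norm_sq).const_mul (η ^ 2)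
  have h2 := (hasDerivAt_radialProfile hd (η ^ 2 * ‖x‖ ^ 2)).comp_hasFDerivAt x h1
  have hd' : (0 : ℝ) < d := by exact_mod_cast hd
  refine h2.congr_fderiv ?_
  ext v
  simp
  field_simp

lemma coordLaplacian_radialEigen (hN : 1 ≤ N) (η : ℝ) (x : Space N) :
    coordLaplacian (radialEigen N η) x = η ^ 2 * radialEigen N η x := by
  have hd : (0 : ℝ) < N := by exact_mod_cast hN
  have h1 : ∀ (y : Space N) (i : Fin N), (∇ (radialEigen N η) y) i =
      η ^ 2 / N * radialProfile (N + 2) (η ^ 2 * ‖y‖ ^ 2) * y i := by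
    intro y i
    have h0 : HasFDerivAt (radialEigen N η) _ y := hasFDerivAt_radialProfile_norm_sq hN η y
    rw [gradient_apply, h0.fderiv]
    simp [EuclideanSpace.inner_single_right]
  have h2 : ∀ i : Fin N, (∇ (fun y => (∇ (radialEigen N η) y) i) x) i =
      η ^ 2 / N * (radialProfile (N + 2) (η ^ 2 * ‖x‖ ^ 2) +
        η ^ 2 / (N + 2) * radialProfile (N + 4) (η ^ 2 * ‖x‖ ^ 2) * (x i) ^ 2) := by
    intro i
    simp_rw [h1]
    rw [gradient_apply]
    have ha := (hasFDerivAt_radialProfile_norm_sq (d := N + 2) (by omega) η x).const_mul (η ^ 2 / N)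
    have hb : HasFDerivAt (fun y : Space N => y i) (EuclideanSpace.proj i : Space N →L[ℝ] ℝ) x :=
      (EuclideanSpace.proj i : Space N →L[ℝ] ℝ).hasFDerivAt
    have hab : HasFDerivAt (fun y : Space N =>
      η ^ 2 / N * radialProfile (N + 2) (η ^ 2 * ‖y‖ ^ 2) * y i) _ x := ha.mul hb
    rw [hab.fderiv]
    simp [EuclideanSpace.inner_single_right]
    ring
  unfold coordLaplacian
  simp_rw [h2]
  rw [← Finset.mul_sum, Finset.sum_add_distrib, ← Finset.mul_sum]
  have h3 : ∑ i, (x i) ^ 2 = ‖x‖ ^ 2 := by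
    rw [EuclideanSpace.norm_sq_eq]; simp
  rw [h3]
  have h4 := radialProfile_ode hN (η ^ 2 * ‖x‖ ^ 2)
  unfold radialEigen
  rw [← h4]
  simp
  field_simp
  ring

/-! ### Growth of the eigenfunction, pointwise and integrated over balls. -/

lemma radialProfile_mono {d : ℕ} (hd : 1 ≤ d) {y z : ℝ} (hy : 0 ≤ y) (hyz : y ≤ z) :
    radialProfile d y ≤ radialProfile d z :=
  Summable.tsum_le_tsum (fun k => mul_le_mul_of_nonneg_left (pow_le_pow_left₀ hy hyz k)
    (radialCoeff_pos hd k).le) (summable_radialCoeff_mul_pow hd y) (summable_radialCoeff_mul_pow hd z)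

lemma exists_radialEigen_le (hN : 1 ≤ N) {η : ℝ} (hη : 1 ≤ η) :
    ∃ C : ℝ, 0 < C ∧ ∀ x : Space N, radialEigen N η x ≤
      C * ((1 + ‖x‖) ^ (-((N : ℝ) - 1) / 2) * Real.exp (η * ‖x‖)) := by
  set e : ℝ := -((N : ℝ) - 1) / 2 with he
  have he0 : e ≤ 0 := by
    have : (1 : ℝ) ≤ N := by exact_mod_cast hN
    rw [he]; linarith
  set A : ℝ := Real.sqrt ((N - 1).factorial) * 2⁻¹ ^ e with hA
  set B : ℝ := radialProfile N 1 * 2⁻¹ ^ e with hB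
  have hA0 : 0 < A := by positivity
  have hB0 : 0 < B := mul_pos (by linarith [one_le_radialProfile hN (zero_le_one' ℝ)]) (by positivity)
  refine ⟨A + B, by positivity, fun x => ?_⟩
  have hX : 0 ≤ (1 + ‖x‖) ^ e * Real.exp (η * ‖x‖) := by positivity
  have hx0 := norm_nonneg x
  unfold radialEigen
  by_cases h : η * ‖x‖ < 1
  · have h1 : radialProfile N (η ^ 2 * ‖x‖ ^ 2) ≤ radialProfile N 1 := by
      refine radialProfile_mono hN (by positivity) ?_
      rw [← mul_pow]
      exact pow_le_one₀ (by positivity) h.le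
    have h2 : (1 : ℝ) ≤ 2⁻¹ ^ e * (1 + ‖x‖) ^ e := by
      rw [← Real.mul_rpow (by norm_num) (by positivity)]
      apply Real.one_le_rpow_of_pos_of_le_one_of_nonpos (by positivity) _ he0
      nlinarith
    have h3 : (1 : ℝ) ≤ Real.exp (η * ‖x‖) := Real.one_le_exp (by positivity)
    have h4 : radialProfile N 1 ≤ B * ((1 + ‖x‖) ^ e * Real.exp (η * ‖x‖)) := by
      have := mul_le_mul h2 h3 zero_le_one (by positivity)
      have h5 := mul_le_mul_of_nonneg_left this (le_trans zero_le_one (one_le_radialProfile hN (zero_le_one' ℝ)))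
      rw [hB]
      linarith
    nlinarith [mul_nonneg hA0.le hX]
  · push Not at h
    have hpos : 0 < η * ‖x‖ := by linarith
    have h1 := radialProfile_sq_le hN hpos
    -- Here η‖x‖ is at least 1 and at least ‖x‖, hence at least (1 + ‖x‖)/2, and the exponent is
    -- nonpositive.
    have h2 : (η * ‖x‖) ^ e ≤ 2⁻¹ ^ e * (1 + ‖x‖) ^ e := by
      rw [← Real.mul_rpow (by norm_num) (by positivity)]
      apply Real.rpow_le_rpow_of_nonpos (by positivity) _ he0
      nlinarith
    rw [mul_pow] at h1
    calc _ ≤ _ := h1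
      _ ≤ Real.sqrt ((N - 1).factorial) * ((2⁻¹ ^ e * (1 + ‖x‖) ^ e) * Real.exp (η * ‖x‖)) := by
        gcongr
      _ = A * ((1 + ‖x‖) ^ e * Real.exp (η * ‖x‖)) := by rw [hA]; ring
      _ ≤ _ := by nlinarith [mul_nonneg hB0.le hX]

lemma exists_one_add_rpow_le_exp (s : ℝ) {k : ℝ} (hk : 0 < k) :
    ∃ C : ℝ, 0 < C ∧ ∀ y : ℝ, 0 ≤ y → (1 + y) ^ s ≤ C * Real.exp (k * y) := by
  obtain ⟨M, hM⟩ := Filter.eventually_atTop.1 ((isLittleO_rpow_exp_pos_mul_atTop s hk).bound one_pos)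
  set M' := max M 1
  have hcont : ContinuousOn (fun z : ℝ => z ^ s) (Icc 1 M') := fun z hz =>
    (Real.continuousAt_rpow_const z s (Or.inl (by linarith [hz.1]))).continuousWithinAt
  obtain ⟨D, hD⟩ := isCompact_Icc.bddAbove_image hcont
  refine ⟨|D| + Real.exp k, by positivity, fun y hy => ?_⟩
  by_cases h : 1 + y ≤ M'
  · have h1 : (1 + y) ^ s ≤ D := hD ⟨1 + y, ⟨by linarith, h⟩, rfl⟩
    have h2 : 1 ≤ Real.exp (k * y) := Real.one_le_exp (by positivity)
    have h3 := le_abs_self D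
    nlinarith [abs_nonneg D, Real.exp_pos k]
  · have h1 := hM (1 + y) (by linarith [le_max_left M 1])
    rw [Real.norm_eq_abs, Real.norm_eq_abs, abs_of_pos (Real.rpow_pos_of_pos (by linarith) _),
      abs_of_pos (Real.exp_pos _), one_mul, mul_add, mul_one, Real.exp_add] at h1
    nlinarith [abs_nonneg D, Real.exp_pos (k * y)]

/-- A Peetre-type inequality: moving the base point from r to ρ costs only a power of 1 + (ρ - r),
whatever the sign of s. -/
lemma one_add_rpow_le (s : ℝ) {r ρ : ℝ} (hr : 0 ≤ r) (hρ : r ≤ ρ) :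
    (1 + r) ^ s ≤ (1 + ρ) ^ s * (1 + (ρ - r)) ^ |s| := by
  rcases le_total 0 s with h | h
  · calc (1 + r) ^ s ≤ (1 + ρ) ^ s := by gcongr
      _ ≤ _ := le_mul_of_one_le_right (Real.rpow_nonneg (by linarith) _)
        (Real.one_le_rpow (by linarith) (abs_nonneg _))
  · rw [abs_of_nonpos h]
    have h1 : (1 + ρ) ≤ (1 + r) * (1 + (ρ - r)) := by nlinarith
    have h2 := Real.rpow_le_rpow_of_nonpos (by linarith) h1 h
    rw [Real.mul_rpow (by linarith) (by linarith)] at h2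
    have h3 : (0 : ℝ) < (1 + (ρ - r)) ^ (-s) := Real.rpow_pos_of_pos (by linarith) _
    have h4 : (1 + (ρ - r)) ^ s * (1 + (ρ - r)) ^ (-s) = 1 := by
      rw [← Real.rpow_add (by linarith)]; simp
    calc (1 + r) ^ s = (1 + r) ^ s * (1 + (ρ - r)) ^ s * (1 + (ρ - r)) ^ (-s) := by
          rw [mul_assoc, h4, mul_one]
      _ ≤ _ := by gcongr

/-- The integral is concentrated near r = ρ. Half of the exponential decay in ρ - r absorbs the
polynomial loss of `one_add_rpow_le`, and the other half is integrated. -/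
lemma exists_integral_rpow_mul_exp_le (s : ℝ) {k : ℝ} (hk : 0 < k) :
    ∃ C : ℝ, 0 < C ∧ ∀ ρ : ℝ, 0 ≤ ρ →
      ∫ r in (0 : ℝ)..ρ, (1 + r) ^ s * Real.exp (k * r) ≤ C * ((1 + ρ) ^ s * Real.exp (k * ρ)) := by
  obtain ⟨C, hC, h⟩ := exists_one_add_rpow_le_exp |s| (half_pos hk)
  refine ⟨C * (2 / k), by positivity, fun ρ hρ => ?_⟩
  have hI : ∫ r in (0 : ℝ)..ρ, Real.exp (k / 2 * r) ≤ 2 / k * Real.exp (k / 2 * ρ) := by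
    rw [intervalIntegral.integral_comp_mul_left (fun x => Real.exp x) (by positivity), integral_exp]
    have : (k / 2)⁻¹ = 2 / k := by rw [inv_div]
    rw [this, smul_eq_mul]
    gcongr
    simp
  calc ∫ r in (0 : ℝ)..ρ, (1 + r) ^ s * Real.exp (k * r)
      ≤ ∫ r in (0 : ℝ)..ρ, C * (1 + ρ) ^ s * Real.exp (k / 2 * ρ) * Real.exp (k / 2 * r) := by
        apply intervalIntegral.integral_mono_on hρ
        · apply ContinuousOn.intervalIntegrable
          intro r hr
          rw [uIcc_of_le hρ] at hr
          refine ContinuousWithinAt.mul ?_ (by fun_prop)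
          exact ((continuousAt_const.add continuousAt_id).rpow_const
            (Or.inl (by simp; linarith [hr.1]))).continuousWithinAt
        · apply Continuous.intervalIntegrable; fun_prop
        · intro r hr
          have h1 := one_add_rpow_le s hr.1 hr.2
          have h2 := h (ρ - r) (by linarith [hr.2])
          have h0 : (0 : ℝ) < (1 + ρ) ^ s := by positivity
          calc (1 + r) ^ s * Real.exp (k * r)
              ≤ (1 + ρ) ^ s * (C * Real.exp (k / 2 * (ρ - r))) * Real.exp (k * r) := by
                gcongr
                exact h1.trans (by gcongr)
            _ = C * (1 + ρ) ^ s * (Real.exp (k / 2 * (ρ - r)) * Real.exp (k * r)) := by ring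
            _ = C * (1 + ρ) ^ s * (Real.exp (k / 2 * ρ) * Real.exp (k / 2 * r)) := by
                rw [← Real.exp_add, ← Real.exp_add]; ring_nf
            _ = _ := by ring
    _ = C * (1 + ρ) ^ s * Real.exp (k / 2 * ρ) * ∫ r in (0 : ℝ)..ρ, Real.exp (k / 2 * r) := by
        rw [intervalIntegral.integral_const_mul]
    _ ≤ C * (1 + ρ) ^ s * Real.exp (k / 2 * ρ) * (2 / k * Real.exp (k / 2 * ρ)) := by
        gcongr
    _ = C * (2 / k) * ((1 + ρ) ^ s * (Real.exp (k / 2 * ρ) * Real.exp (k / 2 * ρ))) := by ring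
    _ = _ := by rw [← Real.exp_add]; ring_nf

/-- Growth of the `L ^ c` norm of the radial eigenfunction over balls. -/
lemma exists_integral_radialEigen_rpow_le (hN : 1 ≤ N) {η : ℝ} (hη : 1 ≤ η) {c : ℝ} (hc : 0 < c) :
    ∃ C : ℝ, 0 < C ∧ ∀ ρ : ℝ, 0 ≤ ρ →
      ∫ x in Metric.closedBall (0 : Space N) ρ, radialEigen N η x ^ c ≤
        C * ((1 + ρ) ^ (((N : ℝ) - 1) * (1 - c / 2)) * Real.exp (c * η * ρ)) := by
  obtain ⟨A, hA, hle⟩ := exists_radialEigen_le hN hη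
  set m : ℝ := (N : ℝ) - 1 with hm
  obtain ⟨D, hD, hint⟩ := exists_integral_rpow_mul_exp_le (m * (1 - c / 2)) (k := c * η) (by positivity)
  set κ : ℝ := volume.real (Metric.ball (0 : Space N) 1) with hκ
  have hN0 : (0 : ℝ) < N := by exact_mod_cast hN
  refine ⟨A ^ c * (N * (κ + 1) * D), ?_, fun ρ hρ => ?_⟩
  · have : 0 ≤ κ := measureReal_nonneg
    positivity
  have : Nontrivial (Space N) := by
    have : Nonempty (Fin N) := ⟨⟨0, hN⟩⟩
    infer_instance
  set G : ℝ → ℝ := (Iic ρ).indicator fun r => (1 + r) ^ (-m / 2 * c) * Real.exp (c * η * r) with hG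
  have hGx : ∀ x : Space N, (Metric.closedBall (0 : Space N) ρ).indicator
      (fun x => (1 + ‖x‖) ^ (-m / 2 * c) * Real.exp (c * η * ‖x‖)) x = G ‖x‖ := by
    intro x
    simp only [hG, indicator, Metric.mem_closedBall, dist_zero_right, mem_Iic]
  have hcont : Continuous fun x : Space N => (1 + ‖x‖) ^ (-m / 2 * c) * Real.exp (c * η * ‖x‖) := by
    refine Continuous.mul ?_ (by fun_prop)
    exact (by fun_prop : Continuous fun x : Space N => 1 + ‖x‖).rpow_const
      (fun x => Or.inl (by positivity))
  have h1 : ∫ x in Metric.closedBall (0 : Space N) ρ, radialEigen N η x ^ c ≤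
      ∫ x in Metric.closedBall (0 : Space N) ρ,
        A ^ c * ((1 + ‖x‖) ^ (-m / 2 * c) * Real.exp (c * η * ‖x‖)) := by
    refine setIntegral_mono_on ?_ ?_ measurableSet_closedBall fun x _ => ?_
    · refine ContinuousOn.integrableOn_compact (isCompact_closedBall _ _) (Continuous.continuousOn ?_)
      exact (contDiff_radialEigen hN η).continuous.rpow_const
        (fun x => Or.inl (by linarith [one_le_radialEigen hN η x]))
    · exact (hcont.const_mul _).continuousOn.integrableOn_compact (isCompact_closedBall _ _)
    · calc radialEigen N η x ^ c
          ≤ (A * ((1 + ‖x‖) ^ (-m / 2) * Real.exp (η * ‖x‖))) ^ c :=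
            Real.rpow_le_rpow (by linarith [one_le_radialEigen hN η x]) (hle x) hc.le
        _ = _ := by
          rw [Real.mul_rpow hA.le (by positivity), Real.mul_rpow (by positivity) (by positivity),
            ← Real.rpow_mul (by positivity), ← Real.exp_mul]
          ring_nf
  refine h1.trans ?_
  rw [integral_const_mul, ← integral_indicator measurableSet_closedBall]
  simp_rw [hGx]
  rw [integral_fun_norm_addHaar]
  have hfin : Module.finrank ℝ (Space N) = N := by simp
  rw [hfin, ← hκ]
  have h2 : ∫ y in Ioi (0 : ℝ), y ^ (N - 1) • G y ≤
      D * ((1 + ρ) ^ (m * (1 - c / 2)) * Real.exp (c * η * ρ)) := by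
    refine le_trans ?_ (hint ρ hρ)
    have : (fun y => y ^ (N - 1) • G y) = (Iic ρ).indicator
        fun y => y ^ (N - 1) * ((1 + y) ^ (-m / 2 * c) * Real.exp (c * η * y)) := by
      ext y
      simp only [hG, indicator, smul_eq_mul]
      split_ifs <;> simp
    rw [this, setIntegral_indicator measurableSet_Iic, Ioi_inter_Iic, intervalIntegral.integral_of_le hρ]
    have hco : ∀ e : ℝ, ContinuousOn (fun y : ℝ => (1 + y) ^ e) (Icc 0 ρ) := fun e y hy =>
      ((continuousAt_const.add continuousAt_id).rpow_const
            (Or.inl (by simp; linarith [hy.1]))).continuousWithinAt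
    refine setIntegral_mono_on ?_ ?_ measurableSet_Ioc fun y hy => ?_
    · refine IntegrableOn.mono_set (ContinuousOn.integrableOn_compact isCompact_Icc ?_) Ioc_subset_Icc_self
      exact ContinuousOn.mul (by fun_prop) ((hco _).mul (by fun_prop))
    · refine IntegrableOn.mono_set (ContinuousOn.integrableOn_compact isCompact_Icc ?_) Ioc_subset_Icc_self
      exact (hco _).mul (by fun_prop)
    · have hy0 := hy.1
      have e1 : y ^ (N - 1) ≤ (1 + y) ^ m := by
        rw [hm, show (N : ℝ) - 1 = ((N - 1 : ℕ) : ℝ) by push_cast [hN]; ring, Real.rpow_natCast]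
        gcongr; linarith
      calc _ ≤ (1 + y) ^ m * ((1 + y) ^ (-m / 2 * c) * Real.exp (c * η * y)) := by gcongr
        _ = _ := by
          rw [← mul_assoc, ← Real.rpow_add (by linarith)]
          ring_nf
  have hκ0 : 0 ≤ κ := measureReal_nonneg
  have hX : 0 ≤ D * ((1 + ρ) ^ (m * (1 - c / 2)) * Real.exp (c * η * ρ)) := by positivity
  rw [nsmul_eq_mul, smul_eq_mul]
  calc A ^ c * (N * (κ * ∫ y in Ioi (0 : ℝ), y ^ (N - 1) • G y))
      ≤ A ^ c * (N * (κ * (D * ((1 + ρ) ^ (m * (1 - c / 2)) * Real.exp (c * η * ρ))))) := by gcongr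
    _ ≤ A ^ c * (N * ((κ + 1) * (D * ((1 + ρ) ^ (m * (1 - c / 2)) * Real.exp (c * η * ρ))))) := by
        gcongr; linarith
    _ = _ := by ring

/-- Hölder's inequality, raised to the power `p`. -/
lemma abs_integral_mul_rpow_le {α : Type*} [MeasurableSpace α] {m : Measure α} {p : ℝ} (hp : 1 < p)
    {v w : α → ℝ} (hv : AEStronglyMeasurable v m) (hw : AEStronglyMeasurable w m)
    (hvp : Integrable (fun x => |v x| ^ p) m) (hwp : Integrable (fun x => |w x| ^ (p / (p - 1))) m) :
    |∫ x, v x * w x ∂m| ^ p ≤ (∫ x, |v x| ^ p ∂m) * (∫ x, |w x| ^ (p / (p - 1)) ∂m) ^ (p - 1) := by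
  have hp0 : 0 < p := by linarith
  have hp1 : 0 < p - 1 := by linarith
  have hpq : p.HolderConjugate (p / (p - 1)) := Real.HolderConjugate.conjExponent hp
  have hq0 : 0 < p / (p - 1) := by positivity
  have hV : MemLp (fun x => |v x|) (ENNReal.ofReal p) m := by
    have := (integrable_norm_rpow_iff (p := ENNReal.ofReal p) hv (by simpa using hp0) (by simp)).1
      (by simpa [ENNReal.toReal_ofReal hp0.le] using hvp)
    exact this.norm
  have hW : MemLp (fun x => |w x|) (ENNReal.ofReal (p / (p - 1))) m := by
    have := (integrable_norm_rpow_iff (p := ENNReal.ofReal (p / (p - 1))) hw (by simpa using hq0)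
      (by simp)).1 (by simpa [ENNReal.toReal_ofReal hq0.le] using hwp)
    exact this.norm
  have h := integral_mul_le_Lp_mul_Lq_of_nonneg hpq (Filter.Eventually.of_forall fun x => abs_nonneg (v x))
    (Filter.Eventually.of_forall fun x => abs_nonneg (w x)) hV hW
  have h1 : |∫ x, v x * w x ∂m| ≤ ∫ x, |v x| * |w x| ∂m := by
    simpa [abs_mul] using abs_integral_le_integral_abs (f := fun x => v x * w x) (μ := m)
  have hI : 0 ≤ ∫ x, |v x| ^ p ∂m := integral_nonneg fun x => by positivity
  have hJ : 0 ≤ ∫ x, |w x| ^ (p / (p - 1)) ∂m := integral_nonneg fun x => by positivity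
  calc |∫ x, v x * w x ∂m| ^ p
      ≤ ((∫ x, |v x| ^ p ∂m) ^ (1 / p) * (∫ x, |w x| ^ (p / (p - 1)) ∂m) ^ (1 / (p / (p - 1)))) ^ p :=
        Real.rpow_le_rpow (abs_nonneg _) (h1.trans h) hp0.le
    _ = _ := by
      rw [Real.mul_rpow (by positivity) (by positivity), ← Real.rpow_mul hI, ← Real.rpow_mul hJ]
      congr 1
      · rw [one_div, inv_mul_cancel₀ hp0.ne', Real.rpow_one]
      · congr 1; field_simp

/-! ### Pairings of curves in L² with test functions, and the weak formulation. -/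

open Filter Topology

lemma memLp_of_continuous_compactSupport {E : Type*} [NormedAddCommGroup E] {b : Space N → E}
    (hb : Continuous b) (hbc : HasCompactSupport b) : MemLp b 2 volume :=
  hb.memLp_of_hasCompactSupport hbc

/-- Since moments are continuous linear functionals on L², they inherit continuity and
differentiability in time from the curve. -/
lemma exists_pairing_clm {b : Space N → ℝ} (hb : Continuous b) (hbc : HasCompactSupport b) :
    ∃ ℓ : LTwo N →L[ℝ] ℝ, ∀ v : LTwo N, ℓ v = ∫ x, v x * b x := by
  have hm := memLp_of_continuous_compactSupport hb hbc
  refine ⟨innerSL ℝ (hm.toLp b), fun v => ?_⟩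
  rw [innerSL_apply_apply, L2.inner_def]
  refine integral_congr_ae ?_
  filter_upwards [hm.coeFn_toLp] with x hx
  rw [hx]
  simp

lemma hasDerivWithinAt_pairing {b : Space N → ℝ} (hb : Continuous b) (hbc : HasCompactSupport b)
    {u : ℝ → LTwo N} {u' : LTwo N} {s : Set ℝ} {t : ℝ} (h : HasDerivWithinAt u u' s t) :
    HasDerivWithinAt (fun t => ∫ x, u t x * b x) (∫ x, u' x * b x) s t := by
  obtain ⟨ℓ, hℓ⟩ := exists_pairing_clm hb hbc
  simp_rw [← hℓ]
  exact ℓ.hasFDerivAt.comp_hasDerivWithinAt t h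

lemma continuousOn_pairing {b : Space N → ℝ} (hb : Continuous b) (hbc : HasCompactSupport b)
    {u : ℝ → LTwo N} {s : Set ℝ} (h : ContinuousOn u s) :
    ContinuousOn (fun t => ∫ x, u t x * b x) s := by
  obtain ⟨ℓ, hℓ⟩ := exists_pairing_clm hb hbc
  simp_rw [← hℓ]
  exact ℓ.continuous.comp_continuousOn h

lemma integrable_pairing {b : Space N → ℝ} (hb : Continuous b) (hbc : HasCompactSupport b)
    (v : LTwo N) : Integrable fun x => v x * b x :=
  (Lp.memLp v).integrable_mul (memLp_of_continuous_compactSupport hb hbc)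

/-- The weak gradient is tested against each partial derivative of b, keeping the matching
component, and the results are summed. -/
lemma integral_inner_gradient {v : LTwo N} {w : LTwoVec N} (h : HasWeakGradient v w)
    {b : Space N → ℝ} (hb : ContDiff ℝ ∞ b) (hbc : HasCompactSupport b) :
    ∫ x, inner ℝ (w x) (∇ b x) = - ∫ x, v x * coordLaplacian b x := by
  have hwi : ∀ i : Fin N, MemLp (fun x => (w x) i) 2 volume := fun i =>
    (EuclideanSpace.proj i : Space N →L[ℝ] ℝ).comp_memLp' (Lp.memLp w)
  have hi : ∀ i : Fin N, ∫ x, v x * (∇ (fun y => (∇ b y) i) x) i = - ∫ x, (∇ b x) i * (w x) i := by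
    intro i
    have hc := contDiff_gradient_apply hb i
    have hs := hasCompactSupport_gradient_apply hbc i
    have h1 := h _ hc hs
    have hg : MemLp (∇ fun y => (∇ b y) i) 2 volume := by
      refine memLp_of_continuous_compactSupport ?_ ?_
      · unfold gradient
        exact (LinearIsometryEquiv.continuous _).comp (hc.continuous_fderiv (by simp))
      · unfold gradient
        exact (hs.fderiv ℝ).comp_left (map_zero _)
    have hint1 : Integrable fun x => v x • ∇ (fun y => (∇ b y) i) x := by
      rw [← memLp_one_iff_integrable]
      exact hg.smul (Lp.memLp v)
    have hint2 : Integrable fun x => (∇ b x) i • w x := by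
      rw [← memLp_one_iff_integrable]
      exact (Lp.memLp w).smul (memLp_of_continuous_compactSupport hc.continuous hs)
    have h2 := congrArg (EuclideanSpace.proj i : Space N →L[ℝ] ℝ) h1
    rw [map_neg, ← ContinuousLinearMap.integral_comp_comm _ hint1,
      ← ContinuousLinearMap.integral_comp_comm _ hint2] at h2
    simpa using h2
  have hsum : ∀ x, inner ℝ (w x) (∇ b x) = ∑ i, (∇ b x) i * (w x) i := fun x => by
    rw [PiLp.inner_apply]; simp
  simp_rw [hsum]
  rw [integral_finsetSum]
  · unfold coordLaplacian
    simp_rw [Finset.mul_sum]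
    rw [integral_finsetSum]
    · simp_rw [hi]
      simp
    · intro i _
      have hc := contDiff_gradient_apply (contDiff_gradient_apply hb i) i
      have hs := hasCompactSupport_gradient_apply (hasCompactSupport_gradient_apply hbc i) i
      exact integrable_pairing hc.continuous hs v
  · intro i _
    exact (memLp_of_continuous_compactSupport (contDiff_gradient_apply hb i).continuous
      (hasCompactSupport_gradient_apply hbc i)).integrable_mul (hwi i)

lemma gradient_const_mul_fun {b : Space N → ℝ} (hb : ContDiff ℝ ∞ b) (c : ℝ) (x : Space N) :
    ∇ (fun y => c * b y) x = c • ∇ b x := by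
  ext i
  rw [PiLp.smul_apply, gradient_apply, gradient_apply, smul_eq_mul,
    fderiv_const_mul (hb.differentiable (by simp) x)]
  simp

lemma isTestFunction_mul {T : EReal} {A : ℝ → ℝ} {b : Space N → ℝ} (hA : ContDiff ℝ ∞ A)
    (hAc : HasCompactSupport A) (hAT : ∀ s ∈ tsupport A, (s : EReal) < T) (hb : ContDiff ℝ ∞ b)
    (hbc : HasCompactSupport b) : IsTestFunction T fun x s => A s * b x := by
  have hz : ∀ z : Space N × ℝ, z ∉ tsupport b ×ˢ tsupport A → A z.2 * b z.1 = 0 := by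
    intro z hz
    rw [mem_prod, not_and_or] at hz
    rcases hz with h | h
    · rw [image_eq_zero_of_notMem_tsupport h, mul_zero]
    · rw [image_eq_zero_of_notMem_tsupport h, zero_mul]
  refine ⟨(hA.comp contDiff_snd).mul (hb.comp contDiff_fst),
    HasCompactSupport.intro (hbc.isCompact.prod hAc.isCompact) fun z h => hz z h, fun z h => ?_⟩
  have hsub : tsupport (fun z : Space N × ℝ => A z.2 * b z.1) ⊆ tsupport b ×ˢ tsupport A := by
    refine closure_minimal (fun z h => ?_) ((isClosed_tsupport b).prod (isClosed_tsupport A))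
    by_contra hn
    exact h (hz z hn)
  exact hAT _ (hsub h).2

lemma mem_timeInterval_of_le {T : EReal} {s t : ℝ} (ht : t ∈ timeInterval T) (hs : 0 ≤ s)
    (hst : s ≤ t) : s ∈ timeInterval T :=
  ⟨hs, lt_of_le_of_lt (by exact_mod_cast hst) ht.2⟩

lemma Icc_subset_timeInterval {T : EReal} {t : ℝ} (ht : t ∈ timeInterval T) :
    Icc 0 t ⊆ timeInterval T := fun _ hs => mem_timeInterval_of_le ht hs.1 hs.2

/-- The support must avoid s ≤ -1 so that the cutoff times any real power of 1 + s is smooth on the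
whole line. It equals 1 near the closed interval, so that time derivatives are unaffected there. -/
lemma exists_time_cutoff {T : EReal} {t : ℝ} (ht : t ∈ timeInterval T) :
    ∃ χ : ℝ → ℝ, ContDiff ℝ ∞ χ ∧ HasCompactSupport χ ∧
      (∀ s ∈ tsupport χ, -1 < s ∧ (s : EReal) < T) ∧ ∀ s ∈ Icc 0 t, χ =ᶠ[𝓝 s] fun _ => 1 := by
  obtain ⟨t', h1, h2⟩ := EReal.lt_iff_exists_real_btwn.1 ht.2
  have h1' : t < t' := by exact_mod_cast h1
  have ht0 := ht.1
  set θ : ℝ := min (1 / 4) ((t' - t) / 4) with hθ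
  have hθ0 : 0 < θ := lt_min (by norm_num) (by linarith)
  have hθ1 : θ ≤ 1 / 4 := min_le_left _ _
  have hθ2 : θ ≤ (t' - t) / 4 := min_le_right _ _
  let f : ContDiffBump (t / 2) := ⟨t / 2 + θ, t / 2 + 2 * θ, by linarith, by linarith⟩
  refine ⟨f, f.contDiff, f.hasCompactSupport, fun s hs => ?_, fun s hs => ?_⟩
  · rw [f.tsupport_eq, Metric.mem_closedBall, Real.dist_eq, abs_le] at hs
    have : f.rOut = t / 2 + 2 * θ := rfl
    rw [this] at hs
    refine ⟨by linarith [hs.1], lt_trans ?_ h2⟩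
    have : s < t' := by linarith [hs.2]
    exact_mod_cast this
  · refine f.eventuallyEq_one_of_mem_ball ?_
    rw [Metric.mem_ball, Real.dist_eq, abs_lt]
    have : f.rIn = t / 2 + θ := rfl
    rw [this]
    constructor <;> linarith [hs.1, hs.2]

lemma exists_time_weight {T : EReal} {t : ℝ} (ht : t ∈ timeInterval T) (e : ℝ) :
    ∃ A : ℝ → ℝ, ContDiff ℝ ∞ A ∧ HasCompactSupport A ∧ (∀ s ∈ tsupport A, (s : EReal) < T) ∧
      ∀ s ∈ Icc 0 t, A s = (1 + s) ^ e ∧ deriv A s = e * (1 + s) ^ (e - 1) := by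
  obtain ⟨χ, hχ, hχc, hχT, hχ1⟩ := exists_time_cutoff ht
  refine ⟨fun s => χ s * (1 + s) ^ e, ?_, hχc.mul_right, fun s hs => ?_, fun s hs => ?_⟩
  · rw [contDiff_iff_contDiffAt]
    intro s
    by_cases hs : s ∈ tsupport χ
    · have h1 := (hχT s hs).1
      exact hχ.contDiffAt.mul ((contDiffAt_const.add contDiffAt_id).rpow_const_of_ne (by simp; linarith))
    · have h0 : (fun s => χ s * (1 + s) ^ e) =ᶠ[𝓝 s] fun _ => 0 := by
        filter_upwards [notMem_tsupport_iff_eventuallyEq.1 hs] with y hy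
        rw [hy]; simp
      exact contDiffAt_const.congr_of_eventuallyEq h0
  · exact (hχT s (closure_mono (Function.support_mul_subset_left _ _) hs)).2
  · have h1 := hχ1 s hs
    have h2 : (fun s => χ s * (1 + s) ^ e) =ᶠ[𝓝 s] fun s => (1 + s) ^ e := by
      filter_upwards [h1] with y hy
      rw [hy, one_mul]
    refine ⟨h2.self_of_nhds, ?_⟩
    rw [h2.deriv_eq]
    have h3 := ((hasDerivAt_id s).const_add 1).rpow_const (p := e) (Or.inl (by simp; linarith [hs.1]))
    simpa using h3.deriv

lemma continuousOn_one_add_rpow (e t : ℝ) : ContinuousOn (fun s : ℝ => (1 + s) ^ e) (Icc 0 t) :=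
  fun s hs => ((continuousAt_const.add continuousAt_id).rpow_const
    (Or.inl (by simp; linarith [hs.1]))).continuousWithinAt

/-- The weak formulation for products of a power of `1 + t` and a function of `x`. -/
lemma IsEnergySolution.weighted_identity {μ ν p q ε : ℝ} {f g : Space N → ℝ} {T : EReal}
    {u ut : ℝ → LTwo N} {Du : ℝ → LTwoVec N} (h : IsEnergySolution μ ν p q ε f g T u ut Du)
    {b : Space N → ℝ} (hb : ContDiff ℝ ∞ b) (hbc : HasCompactSupport b) (e : ℝ) {t : ℝ}
    (ht : t ∈ timeInterval T) :
    IntervalIntegrable (fun s => (1 + s) ^ e * ∫ x, (|ut s x| ^ p + |u s x| ^ q) * b x) volume 0 t ∧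
    (1 + t) ^ e * (∫ x, ut t x * b x) - ∫ x, ut 0 x * b x =
      (∫ s in (0 : ℝ)..t, ((e - μ) * (1 + s) ^ (e - 1) * (∫ x, ut s x * b x) +
        (1 + s) ^ e * (∫ x, u s x * coordLaplacian b x) -
        ν ^ 2 * (1 + s) ^ (e - 2) * ∫ x, u s x * b x)) +
      ∫ s in (0 : ℝ)..t, (1 + s) ^ e * ∫ x, (|ut s x| ^ p + |u s x| ^ q) * b x := by
  obtain ⟨A, hA, hAc, hAT, hA1⟩ := exists_time_weight ht e
  have htest := isTestFunction_mul hA hAc hAT hb hbc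
  have hint := h.integrable_nonlinearity _ htest t ht
  have hw := h.weak_form _ htest t ht
  have ht0 := ht.1
  have hsub := Icc_subset_timeInterval ht
  have hn : ∀ s, ∫ x, (|ut s x| ^ p + |u s x| ^ q) * (A s * b x) =
      A s * ∫ x, (|ut s x| ^ p + |u s x| ^ q) * b x := fun s => by
    rw [← integral_const_mul]; congr 1; ext x; ring
  have hcongr : EqOn (fun s => ∫ x, (|ut s x| ^ p + |u s x| ^ q) * (A s * b x))
      (fun s => (1 + s) ^ e * ∫ x, (|ut s x| ^ p + |u s x| ^ q) * b x) (uIcc 0 t) := fun s hs => by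
    rw [uIcc_of_le ht0] at hs
    simp only
    rw [hn, (hA1 s hs).1]
  refine ⟨hint.congr (fun s hs => hcongr (uIoc_subset_uIcc hs)), ?_⟩
  rw [intervalIntegral.integral_congr hcongr] at hw
  have e1 : ∀ s, ∫ x, ut s x * (A s * b x) = A s * ∫ x, ut s x * b x := fun s => by
    rw [← integral_const_mul]; congr 1; ext x; ring
  have e2 : EqOn (fun s => ∫ x, ut s x * deriv (fun τ => A τ * b x) s)
      (fun s => e * (1 + s) ^ (e - 1) * ∫ x, ut s x * b x) (uIcc 0 t) := fun s hs => by
    rw [uIcc_of_le ht0] at hs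
    simp only
    rw [← (hA1 s hs).2, ← integral_const_mul]
    congr 1; ext x
    rw [deriv_mul_const (hA.differentiable (by simp) s)]; ring
  have e3 : EqOn (fun s => ∫ x, inner ℝ (Du s x) (∇ (fun y => A s * b y) x))
      (fun s => - ((1 + s) ^ e * ∫ x, u s x * coordLaplacian b x)) (uIcc 0 t) := fun s hs => by
    rw [uIcc_of_le ht0] at hs
    simp only
    simp_rw [gradient_const_mul_fun hb, inner_smul_right]
    rw [integral_const_mul, integral_inner_gradient (h.hasWeakGradient s (hsub hs)) hb hbc,
      (hA1 s hs).1]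
    ring
  have e4 : EqOn (fun s => ∫ x, μ / (1 + s) * ut s x * (A s * b x))
      (fun s => μ * (1 + s) ^ (e - 1) * ∫ x, ut s x * b x) (uIcc 0 t) := fun s hs => by
    rw [uIcc_of_le ht0] at hs
    simp only
    rw [(hA1 s hs).1, ← integral_const_mul]
    congr 1; ext x
    rw [Real.rpow_sub_one (by linarith [hs.1])]; ring
  have e5 : EqOn (fun s => ∫ x, ν ^ 2 / (1 + s) ^ 2 * u s x * (A s * b x))
      (fun s => ν ^ 2 * (1 + s) ^ (e - 2) * ∫ x, u s x * b x) (uIcc 0 t) := fun s hs => by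
    rw [uIcc_of_le ht0] at hs
    simp only
    rw [(hA1 s hs).1, ← integral_const_mul]
    congr 1; ext x
    rw [Real.rpow_sub (by linarith [hs.1]), Real.rpow_ofNat]; ring
  rw [intervalIntegral.integral_congr e2, intervalIntegral.integral_congr e3,
    intervalIntegral.integral_congr e4, intervalIntegral.integral_congr e5, e1, e1,
    (hA1 t ⟨ht0, le_rfl⟩).1, (hA1 0 ⟨le_rfl, ht0⟩).1, add_zero, Real.one_rpow, one_mul] at hw
  have cV := (continuousOn_pairing hb.continuous hbc h.continuousOn_ut).mono hsub
  have cU := (continuousOn_pairing hb.continuous hbc h.continuousOn_u).mono hsub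
  have cL := (continuousOn_pairing (contDiff_coordLaplacian hb).continuous
    (hasCompactSupport_coordLaplacian hbc) h.continuousOn_u).mono hsub
  have ii : ∀ {F : ℝ → ℝ}, ContinuousOn F (Icc 0 t) → IntervalIntegrable F volume 0 t :=
    fun hF => (hF.mono (by rw [uIcc_of_le ht0])).intervalIntegrable
  have i1 : IntervalIntegrable (fun s => e * (1 + s) ^ (e - 1) * ∫ x, ut s x * b x) volume 0 t :=
    ii (((continuousOn_const (c := e)).mul (continuousOn_one_add_rpow (e - 1) t)).mul cV)
  have i2 : IntervalIntegrable (fun s => (1 + s) ^ e * ∫ x, u s x * coordLaplacian b x) volume 0 t :=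
    ii ((continuousOn_one_add_rpow e t).mul cL)
  have i3 : IntervalIntegrable (fun s => μ * (1 + s) ^ (e - 1) * ∫ x, ut s x * b x) volume 0 t :=
    ii (((continuousOn_const (c := μ)).mul (continuousOn_one_add_rpow (e - 1) t)).mul cV)
  have i4 : IntervalIntegrable (fun s => ν ^ 2 * (1 + s) ^ (e - 2) * ∫ x, u s x * b x) volume 0 t :=
    ii (((continuousOn_const (c := ν ^ 2)).mul (continuousOn_one_add_rpow (e - 2) t)).mul cU)
  have hsplit : (∫ s in (0 : ℝ)..t, ((e - μ) * (1 + s) ^ (e - 1) * (∫ x, ut s x * b x) +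
        (1 + s) ^ e * (∫ x, u s x * coordLaplacian b x) -
        ν ^ 2 * (1 + s) ^ (e - 2) * ∫ x, u s x * b x)) =
      (∫ s in (0 : ℝ)..t, e * (1 + s) ^ (e - 1) * ∫ x, ut s x * b x) -
      (∫ s in (0 : ℝ)..t, μ * (1 + s) ^ (e - 1) * ∫ x, ut s x * b x) +
      (∫ s in (0 : ℝ)..t, (1 + s) ^ e * ∫ x, u s x * coordLaplacian b x) -
      ∫ s in (0 : ℝ)..t, ν ^ 2 * (1 + s) ^ (e - 2) * ∫ x, u s x * b x := by
    rw [← intervalIntegral.integral_sub i1 i3, ← intervalIntegral.integral_add (i1.sub i3) i2,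
      ← intervalIntegral.integral_sub ((i1.sub i3).add i2) i4]
    congr 1; ext s; ring
  rw [hsplit]
  rw [intervalIntegral.integral_neg] at hw
  linarith

/-! ### Time slices of curves in L²: integrability and supports. -/

lemma exists_ae_tendsto_of_tendsto {v : ℕ → LTwo N} {w : LTwo N} (h : Tendsto v atTop (𝓝 w)) :
    ∃ k : ℕ → ℕ, StrictMono k ∧ ∀ᵐ x, Tendsto (fun n => v (k n) x) atTop (𝓝 (w x)) :=
  (tendstoInMeasure_of_tendsto_Lp h).exists_seq_tendsto_ae

lemma isClosed_setOf_ae_zero (P : Space N → Prop) :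
    IsClosed {v : LTwo N | ∀ᵐ x, P x → v x = 0} := by
  refine IsSeqClosed.isClosed fun v w hv hw => ?_
  obtain ⟨k, _, hk⟩ := exists_ae_tendsto_of_tendsto hw
  filter_upwards [hk, ae_all_iff.2 fun n => hv (k n)] with x hx hx0 hP
  have : (fun n => v (k n) x) = fun _ => 0 := funext fun n => hx0 n hP
  rw [this] at hx
  exact (tendsto_nhds_unique hx tendsto_const_nhds)

/-- Fatou's lemma along an almost everywhere convergent subsequence. It serves to make r-th power
integrals of a continuous curve in L² measurable in time. -/
lemma lowerSemicontinuous_lintegral_rpow {r : ℝ} (hr : 0 < r) (B : Set (Space N)) :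
    LowerSemicontinuous fun v : LTwo N => ∫⁻ x in B, ENNReal.ofReal (|v x| ^ r) := by
  rw [lowerSemicontinuous_iff_isClosed_preimage]
  intro y
  refine IsSeqClosed.isClosed fun v w hv hw => ?_
  obtain ⟨k, _, hk⟩ := exists_ae_tendsto_of_tendsto hw
  have hm : ∀ v : LTwo N, AEMeasurable (fun x => ENNReal.ofReal (|v x| ^ r)) (volume.restrict B) :=
    fun v => ((((Lp.stronglyMeasurable v).measurable.abs).pow_const r).ennreal_ofReal).aemeasurable
  have h1 : ∫⁻ x in B, ENNReal.ofReal (|w x| ^ r) ≤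
      ∫⁻ x in B, liminf (fun n => ENNReal.ofReal (|v (k n) x| ^ r)) atTop := by
    refine lintegral_mono_ae (ae_restrict_of_ae ?_)
    filter_upwards [hk] with x hx
    have : Tendsto (fun n => ENNReal.ofReal (|v (k n) x| ^ r)) atTop
        (𝓝 (ENNReal.ofReal (|w x| ^ r))) :=
      ENNReal.tendsto_ofReal (hx.abs.rpow_const (Or.inr hr.le))
    rw [this.liminf_eq]
  refine h1.trans ((lintegral_liminf_le' fun n => hm _).trans ?_)
  exact liminf_le_of_le (by isBoundedDefault) fun c hc => by
    obtain ⟨n, hn⟩ := hc.exists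
    exact hn.trans (hv (k n))

/-- A measurable function of time with finite integral is finite almost everywhere. The
measurability comes from `lowerSemicontinuous_lintegral_rpow`. -/
lemma MemLpLoc.ae_integrableOn {r : ℝ} (hr : 0 < r) {T : EReal} {v : ℝ → LTwo N}
    (hv : ContinuousOn v (timeInterval T)) (h : MemLpLoc r T v) {a t : ℝ} (ha : 0 < a)
    (ht : t ∈ timeInterval T) (ρ : ℝ) :
    ∀ᵐ s ∂(volume.restrict (Icc a t)),
      IntegrableOn (fun x => |v s x| ^ r) (Metric.closedBall (0 : Space N) ρ) := by
  have hsub : Icc a t ⊆ timeInterval T := fun s hs =>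
    mem_timeInterval_of_le ht (ha.le.trans hs.1) hs.2
  have hmeas : AEMeasurable (fun s => ∫⁻ x in Metric.closedBall (0 : Space N) ρ,
      ENNReal.ofReal (|v s x| ^ r)) (volume.restrict (Icc a t)) := by
    refine aemeasurable_restrict_of_measurable_subtype measurableSet_Icc ?_
    have hc : Continuous fun s : Icc a t => v s :=
      continuousOn_iff_continuous_domRestrict.1 (hv.mono hsub)
    exact ((lowerSemicontinuous_lintegral_rpow hr _).comp hc).measurable
  filter_upwards [ae_lt_top' hmeas (h a t ρ ha ht.2).ne] with s hs
  refine ⟨(((Lp.stronglyMeasurable (v s)).measurable.abs).pow_const r).aestronglyMeasurable, ?_⟩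
  rw [hasFiniteIntegral_iff_ofReal (Eventually.of_forall fun x => by positivity)]
  exact hs

lemma ae_zero_of_hasDerivWithinAt {u : ℝ → LTwo N} {u' : LTwo N} {t : ℝ} (ht : 0 < t)
    {P : Space N → Prop} (hu : ∀ s ∈ Icc 0 t, ∀ᵐ x, P x → u s x = 0)
    (h : HasDerivWithinAt u u' (Icc 0 t) t) : ∀ᵐ x, P x → u' x = 0 := by
  rw [hasDerivWithinAt_iff_tendsto_slope] at h
  have : (𝓝[Icc 0 t \ {t}] t).NeBot := by
    rw [show Icc 0 t \ {t} = Ico 0 t from Set.Icc_sdiff_right]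
    exact right_nhdsWithin_Ico_neBot ht
  refine (isClosed_setOf_ae_zero P).mem_of_tendsto h ?_
  filter_upwards [self_mem_nhdsWithin] with s hs
  rw [slope_def_module]
  change ∀ᵐ x, P x → ((s - t)⁻¹ • (u s - u t) : LTwo N) x = 0
  filter_upwards [Lp.coeFn_smul ((s - t)⁻¹) (u s - u t), Lp.coeFn_sub (u s) (u t), hu s hs.1,
    hu t ⟨ht.le, le_rfl⟩] with x h1 h2 h3 h4 hP
  rw [h1, Pi.smul_apply, h2, Pi.sub_apply, h3 hP, h4 hP]
  simp

/-! ### Comparison principle and exponential growth for second-order differential inequalities. -/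

lemma monotoneOn_Icc_of_hasDerivWithinAt_nonneg {a b : ℝ} {D D' : ℝ → ℝ}
    (hD : ∀ t ∈ Icc a b, HasDerivWithinAt D (D' t) (Icc a b) t) (h : ∀ t ∈ Ioo a b, 0 ≤ D' t) :
    MonotoneOn D (Icc a b) := by
  refine monotoneOn_of_hasDerivWithinAt_nonneg (convex_Icc a b)
    (fun t ht => (hD t ht).continuousWithinAt) (f' := D') (fun t ht => ?_) (fun t ht => ?_)
  · exact (hD t (interior_subset ht)).mono interior_subset
  · rw [interior_Icc] at ht
    exact h t ht

lemma integral_le_sub_of_hasDerivAt_le {a b : ℝ} (hab : a ≤ b) {M M' k : ℝ → ℝ}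
    (hM : ∀ t ∈ Icc a b, HasDerivAt M (M' t) t) (hk : ContinuousOn k (Icc a b))
    (hle : ∀ t ∈ Icc a b, k t ≤ M' t) : ∫ t in a..b, k t ≤ M b - M a :=
  intervalIntegral.integral_le_sub_of_hasDeriv_right_of_le hab
    (fun t ht => (hM t ht).continuousAt.continuousWithinAt)
    (fun t ht => (hM t (Ioo_subset_Icc_self ht)).hasDerivWithinAt)
    (hk.integrableOn_Icc) (fun t ht => hle t (Ioo_subset_Icc_self ht))

lemma sub_le_integral_of_le_hasDerivAt {a b : ℝ} (hab : a ≤ b) {M M' k : ℝ → ℝ}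
    (hM : ∀ t ∈ Icc a b, HasDerivAt M (M' t) t) (hk : ContinuousOn k (Icc a b))
    (hle : ∀ t ∈ Icc a b, M' t ≤ k t) : M b - M a ≤ ∫ t in a..b, k t :=
  intervalIntegral.sub_le_integral_of_hasDeriv_right_of_le hab
    (fun t ht => (hM t ht).continuousAt.continuousWithinAt)
    (fun t ht => (hM t (Ioo_subset_Icc_self ht)).hasDerivWithinAt)
    (hk.integrableOn_Icc) (fun t ht => hle t (Ioo_subset_Icc_self ht))

/-- Positivity for the second-order inequality `m * deriv D ≥ ∫ W * D`. -/
lemma pos_of_second_order_ineq {a b : ℝ} {D D' m W : ℝ → ℝ}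
    (hD : ∀ t ∈ Icc a b, HasDerivWithinAt D (D' t) (Icc a b) t)
    (hm : ∀ t ∈ Icc a b, 0 < m t) (hW : ∀ t ∈ Icc a b, 0 ≤ W t)
    (hY : ∀ t ∈ Icc a b, ∫ s in a..t, W s * D s ≤ m t * D' t) (ha : 0 < D a) :
    (∀ t ∈ Icc a b, 0 < D t) ∧ ∀ t ∈ Icc a b, 0 ≤ D' t := by
  have step : ∀ t ∈ Icc a b, (∀ s ∈ Icc a t, 0 ≤ D s) → 0 ≤ D' t := by
    intro t ht hs
    have h1 : 0 ≤ ∫ s in a..t, W s * D s := intervalIntegral.integral_nonneg ht.1 fun s hs' =>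
      mul_nonneg (hW s ⟨hs'.1, hs'.2.trans ht.2⟩) (hs s hs')
    exact nonneg_of_mul_nonneg_right (h1.trans (hY t ht)) (hm t ht)
  have hpos : ∀ t ∈ Icc a b, 0 < D t := by
    by_contra! hcon
    obtain ⟨t₀, ht₀, hDt₀⟩ := hcon
    have hcont : ContinuousOn D (Icc a b) := fun t ht => (hD t ht).continuousWithinAt
    -- Let c be the first time at which D is nonpositive. Before c the inequality gives D' ≥ 0, so
    -- D(c) ≥ D(a) > 0, which is absurd.
    set Z : Set ℝ := Icc a b ∩ D ⁻¹' Iic 0 with hZ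
    have hZc : IsClosed Z := hcont.preimage_isClosed_of_isClosed isClosed_Icc isClosed_Iic
    have hZb : BddBelow Z := ⟨a, fun t ht => ht.1.1⟩
    have hmem : sInf Z ∈ Z := hZc.csInf_mem ⟨t₀, ht₀, hDt₀⟩ hZb
    set c := sInf Z
    have hlt : ∀ s ∈ Icc a b, s < c → 0 < D s := by
      intro s hs hsc
      by_contra! hn
      exact absurd (csInf_le hZb (show s ∈ Z from ⟨hs, hn⟩)) (not_le.2 hsc)
    have hsub : Icc a c ⊆ Icc a b := Icc_subset_Icc_right hmem.1.2
    have hmono : MonotoneOn D (Icc a c) := by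
      refine monotoneOn_Icc_of_hasDerivWithinAt_nonneg
        (fun t ht => (hD t (hsub ht)).mono hsub) fun t ht => ?_
      exact step t (hsub (Ioo_subset_Icc_self ht)) fun s hs =>
        (hlt s ⟨hs.1, hs.2.trans (ht.2.le.trans hmem.1.2)⟩ (lt_of_le_of_lt hs.2 ht.2)).le
    have := hmono ⟨le_rfl, hmem.1.1⟩ ⟨hmem.1.1, le_rfl⟩ hmem.1.1
    have h0 : D c ≤ 0 := hmem.2
    linarith
  exact ⟨hpos, fun t ht => step t ht fun s hs => (hpos s ⟨hs.1, hs.2.trans ht.2⟩).le⟩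

lemma hasDerivAt_one_add_rpow (e : ℝ) {t : ℝ} (ht : 0 ≤ t) :
    HasDerivAt (fun s : ℝ => (1 + s) ^ e) (e * (1 + t) ^ (e - 1)) t := by
  have h3 := ((hasDerivAt_id t).const_add 1).rpow_const (p := e) (Or.inl (by simp; linarith))
  simpa using h3

/-- The coefficient of the second-order equation satisfied by the moment against the eigenfunction. -/
noncomputable def massCoeff (η ν t : ℝ) : ℝ := η ^ 2 - ν ^ 2 / (1 + t) ^ 2

lemma continuousOn_massCoeff (η ν : ℝ) : ContinuousOn (massCoeff η ν) (Ici 0) := by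
  unfold massCoeff
  refine continuousOn_const.sub (ContinuousOn.div continuousOn_const (by fun_prop) fun t ht => ?_)
  have : (0 : ℝ) ≤ t := ht
  positivity

/-- A subsolution of the homogeneous equation with damping `μ / (1 + t)` and coefficient `massCoeff η ν`. -/
noncomputable def barrier (μ η t : ℝ) : ℝ := (1 + t) ^ (-μ / 2) * Real.exp (η * t) * (1 + (1 + t)⁻¹)

/-- The derivative of `barrier`. -/
noncomputable def barrierDeriv (μ η t : ℝ) : ℝ := (1 + t) ^ (-μ / 2) * Real.exp (η * t) *
  (η + η * (1 + t)⁻¹ - (1 + t)⁻¹ ^ 2 - μ / 2 * (1 + t)⁻¹ * (1 + (1 + t)⁻¹))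

lemma hasDerivAt_inv_one_add {t : ℝ} (ht : 0 ≤ t) :
    HasDerivAt (fun s : ℝ => (1 + s)⁻¹) (-(1 + t)⁻¹ ^ 2) t := by
  have h := ((hasDerivAt_id t).const_add 1).inv (by simp; linarith)
  refine (h.congr_deriv ?_)
  simp; ring

lemma hasDerivAt_exp_mul (η t : ℝ) :
    HasDerivAt (fun s : ℝ => Real.exp (η * s)) (η * Real.exp (η * t)) t := by
  have h := ((hasDerivAt_id t).const_mul η).exp
  refine h.congr_deriv ?_
  simp; ring

lemma hasDerivAt_barrier (μ η : ℝ) {t : ℝ} (ht : 0 ≤ t) :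
    HasDerivAt (barrier μ η) (barrierDeriv μ η t) t := by
  have h := ((hasDerivAt_one_add_rpow (-μ / 2) ht).mul (hasDerivAt_exp_mul η t)).mul
    ((hasDerivAt_inv_one_add ht).const_add 1)
  refine h.congr_deriv ?_
  rw [Real.rpow_sub_one (by linarith)]
  simp only [barrierDeriv, Pi.mul_apply]
  ring

lemma barrierDeriv_ge {μ η : ℝ} (hμ : 0 ≤ μ) (hη : 1 + μ ≤ η) {t : ℝ} (ht : 0 ≤ t) :
    (1 + t) ^ (-μ / 2) * Real.exp (η * t) ≤ barrierDeriv μ η t := by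
  have hx0 : 0 < (1 + t)⁻¹ := by positivity
  have hx1 : (1 + t)⁻¹ ≤ 1 := inv_le_one_of_one_le₀ (by linarith)
  unfold barrierDeriv
  refine le_mul_of_one_le_right (by positivity) ?_
  set x := (1 + t)⁻¹
  have h1 : x ^ 2 ≤ x := by nlinarith
  have h2 : μ * x ^ 2 ≤ μ * x := mul_le_mul_of_nonneg_left h1 hμ
  have h3 : 0 ≤ (η - 1 - μ) * x := mul_nonneg (by linarith) hx0.le
  nlinarith

/-- With x = (1+t)⁻¹, the leading profile (1+t)^(-μ/2) e^(ηt) alone solves the equation up to a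
relative error of order x² of uncontrolled sign. The factor 1 + x in `barrier` adds -2η x², which
beats all other errors once η is large. -/
lemma integral_barrier_ge {μ ν η : ℝ} (hμ : 0 ≤ μ) (hη : 2 + μ + ν ^ 2 ≤ η) {a t : ℝ} (ha : 0 ≤ a)
    (hat : a ≤ t) :
    (1 + t) ^ μ * barrierDeriv μ η t - (1 + a) ^ μ * barrierDeriv μ η a ≤
      ∫ s in a..t, (1 + s) ^ μ * massCoeff η ν s * barrier μ η s := by
  set g : ℝ → ℝ := fun t => (1 + t) ^ (μ / 2) * Real.exp (η * t) *
    (η + η * (1 + t)⁻¹ - (1 + t)⁻¹ ^ 2 - μ / 2 * (1 + t)⁻¹ * (1 + (1 + t)⁻¹)) with hg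
  have hg' : ∀ s : ℝ, 0 ≤ s → (1 + s) ^ μ * barrierDeriv μ η s = g s := by
    intro s hs
    simp only [hg, barrierDeriv]
    rw [← mul_assoc, ← mul_assoc, ← Real.rpow_add (by linarith)]
    ring_nf
  rw [hg' t (ha.trans hat), hg' a ha]
  have hd : ∀ s : ℝ, 0 ≤ s → HasDerivAt g ((1 + s) ^ (μ / 2) * Real.exp (η * s) *
      ((η + μ / 2 * (1 + s)⁻¹) *
      (η + η * (1 + s)⁻¹ - (1 + s)⁻¹ ^ 2 - μ / 2 * (1 + s)⁻¹ * (1 + (1 + s)⁻¹)) +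
      (-η * (1 + s)⁻¹ ^ 2 + 2 * (1 + s)⁻¹ ^ 3 + μ / 2 * (1 + s)⁻¹ ^ 2 * (1 + 2 * (1 + s)⁻¹)))) s := by
    intro s hs
    have hi := hasDerivAt_inv_one_add hs
    have h := ((hasDerivAt_one_add_rpow (μ / 2) hs).mul (hasDerivAt_exp_mul η s)).mul
      ((((hi.const_mul η).const_add η).sub (hi.pow 2)).sub ((hi.const_mul (μ / 2)).mul (hi.const_add 1)))
    refine h.congr_deriv ?_
    rw [Real.rpow_sub_one (by linarith)]
    simp only [Pi.mul_apply, Pi.sub_apply, Pi.pow_apply]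
    push_cast
    ring
  have hcont : ContinuousOn (fun s => (1 + s) ^ μ * massCoeff η ν s * barrier μ η s) (Icc a t) := by
    intro s hs
    have hs0 := ha.trans hs.1
    exact (((hasDerivAt_one_add_rpow μ hs0).continuousAt.continuousWithinAt).mul
      (((continuousOn_massCoeff η ν) s hs0).mono fun y hy => ha.trans hy.1)).mul
      (hasDerivAt_barrier μ η hs0).continuousAt.continuousWithinAt
  refine sub_le_integral_of_le_hasDerivAt hat (fun s hs => hd s (ha.trans hs.1)) hcont fun s hs => ?_
  have hs0 := ha.trans hs.1
  have hb : (1 + s) ^ μ * massCoeff η ν s * barrier μ η s =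
      (1 + s) ^ (μ / 2) * Real.exp (η * s) * ((η ^ 2 - ν ^ 2 * (1 + s)⁻¹ ^ 2) * (1 + (1 + s)⁻¹)) := by
    have : (1 + s) ^ (μ / 2) = (1 + s) ^ μ * (1 + s) ^ (-μ / 2) := by
      rw [← Real.rpow_add (by linarith)]; ring_nf
    rw [this]
    simp only [massCoeff, barrier, inv_pow, div_eq_mul_inv]
    ring
  rw [hb]
  refine mul_le_mul_of_nonneg_left ?_ (by positivity)
  have hx0 : 0 < (1 + s)⁻¹ := by positivity
  have hx1 : (1 + s)⁻¹ ≤ 1 := inv_le_one_of_one_le₀ (by linarith)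
  set x := (1 + s)⁻¹
  have key : -2 * η - μ / 2 * x - μ ^ 2 / 4 * (1 + x) + 2 * x + μ / 2 * (1 + 2 * x) +
      ν ^ 2 * (1 + x) ≤ 0 := by
    have h1 : ν ^ 2 * x ≤ ν ^ 2 := mul_le_of_le_one_right (sq_nonneg _) hx1
    have h2 : μ * x ≤ μ := mul_le_of_le_one_right hμ hx1
    have h3 : 0 ≤ μ * x := by positivity
    have h4 : 0 ≤ μ ^ 2 / 4 * (1 + x) := by positivity
    linarith
  have h2 : x ^ 2 * (-2 * η - μ / 2 * x - μ ^ 2 / 4 * (1 + x) + 2 * x + μ / 2 * (1 + 2 * x) +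
      ν ^ 2 * (1 + x)) ≤ 0 := mul_nonpos_of_nonneg_of_nonpos (sq_nonneg x) key
  linarith

/-- Exponential lower bound for the derivative `V` of `U` when `(1 + t) ^ μ V` grows at least at the rate
`(1 + t) ^ μ (η ^ 2 - ν ^ 2 / (1 + t) ^ 2) U` and the initial data are nonnegative. -/
lemma exists_exponential_lower_bound {μ ν η : ℝ} (hμ : 0 ≤ μ) (hη : 2 + μ + ν ^ 2 ≤ η) :
    ∃ c : ℝ, 0 < c ∧ ∀ (t₁ : ℝ) (U V : ℝ → ℝ), 1 ≤ t₁ →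
      (∀ t ∈ Icc 0 t₁, HasDerivWithinAt U (V t) (Icc 0 t₁) t) →
      (∀ s ∈ Icc 0 t₁, ∀ t ∈ Icc 0 t₁, s ≤ t →
        ∫ τ in s..t, (1 + τ) ^ μ * massCoeff η ν τ * U τ ≤ (1 + t) ^ μ * V t - (1 + s) ^ μ * V s) →
      0 ≤ U 0 → 0 ≤ V 0 →
      ∀ t ∈ Icc 1 t₁, c * (U 0 + V 0) * ((1 + t) ^ (-μ / 2) * Real.exp (η * t)) ≤ V t := by
  have hbar0 : 0 < barrier μ η 1 := by unfold barrier; positivity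
  have hbar1 : 0 < barrierDeriv μ η 1 :=
    lt_of_lt_of_le (by positivity) (barrierDeriv_ge hμ (by nlinarith [sq_nonneg ν]) zero_le_one)
  refine ⟨2 ^ (-μ) / (barrier μ η 1 + barrierDeriv μ η 1), by positivity, ?_⟩
  intro t₁ U V ht₁ hU hV hU0 hV0
  have hη0 : 0 < η := by nlinarith [sq_nonneg ν]
  have hmass : ∀ t : ℝ, 0 ≤ t → 1 ≤ massCoeff η ν t := by
    intro t ht
    have h1 : ν ^ 2 / (1 + t) ^ 2 ≤ ν ^ 2 := div_le_self (sq_nonneg _) (by nlinarith)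
    unfold massCoeff
    nlinarith [sq_nonneg ν, mul_nonneg hμ hμ]
  have hUc : ContinuousOn U (Icc 0 t₁) := fun t ht => (hU t ht).continuousWithinAt
  have hw : ∀ t : ℝ, 0 ≤ t → 1 ≤ (1 + t) ^ μ := fun t ht => Real.one_le_rpow (by linarith) hμ
  have hWc : ContinuousOn (fun s : ℝ => (1 + s) ^ μ * massCoeff η ν s) (Icc 0 t₁) :=
    (continuousOn_one_add_rpow μ t₁).mul ((continuousOn_massCoeff η ν).mono fun y hy => hy.1)
  have hii : ∀ {F : ℝ → ℝ} {s t : ℝ}, ContinuousOn F (Icc 0 t₁) → s ∈ Icc 0 t₁ → t ∈ Icc 0 t₁ →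
      IntervalIntegrable F volume s t := fun hF hs ht =>
    (hF.mono (uIcc_subset_Icc hs ht)).intervalIntegrable
  have h0mem : (0 : ℝ) ∈ Icc 0 t₁ := ⟨le_rfl, by linarith⟩
  have h1mem : (1 : ℝ) ∈ Icc 0 t₁ := ⟨zero_le_one, ht₁⟩
  have hUpos : ∀ t ∈ Icc 0 t₁, 0 ≤ U t := by
    -- U(0) may vanish, whereas the comparison principle needs a strictly positive start. Adding θ
    -- e^(ηt), itself a subsolution, repairs this, and θ is then sent to 0.
    have hθ : ∀ θ : ℝ, 0 < θ → ∀ t ∈ Icc 0 t₁, 0 < U t + θ * Real.exp (η * t) := by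
      intro θ hθ
      have hzc : Continuous fun s : ℝ => θ * Real.exp (η * s) := by fun_prop
      refine (pos_of_second_order_ineq (D := fun t => U t + θ * Real.exp (η * t))
        (D' := fun t => V t + θ * (η * Real.exp (η * t)))
        (m := fun t => (1 + t) ^ μ) (W := fun t => (1 + t) ^ μ * massCoeff η ν t)
        (fun t ht => (hU t ht).add ((hasDerivAt_exp_mul η t).const_mul θ).hasDerivWithinAt)
        (fun t ht => by have := hw t ht.1; linarith)
        (fun t ht => by have := hw t ht.1; have := hmass t ht.1; positivity) (fun t ht => ?_) ?_).1
      · have h1 := hV 0 h0mem t ht ht.1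
        have h2 : ∫ s in (0 : ℝ)..t, (1 + s) ^ μ * massCoeff η ν s * (θ * Real.exp (η * s)) ≤
            (1 + t) ^ μ * (θ * (η * Real.exp (η * t))) - (1 + 0) ^ μ * (θ * (η * Real.exp (η * 0))) := by
          refine integral_le_sub_of_hasDerivAt_le ht.1 (M := fun t => (1 + t) ^ μ * (θ * (η * Real.exp (η * t))))
            (fun s hs => (hasDerivAt_one_add_rpow μ hs.1).mul
              (((hasDerivAt_exp_mul η s).const_mul η).const_mul θ))
            ((hWc.mul hzc.continuousOn).mono (Icc_subset_Icc_right ht.2)) fun s hs => ?_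
          have e1 : 0 ≤ μ * (1 + s) ^ (μ - 1) * (θ * (η * Real.exp (η * s))) := by
            have := hs.1
            positivity
          have e2 : massCoeff η ν s ≤ η ^ 2 := by
            unfold massCoeff
            have : 0 ≤ ν ^ 2 / (1 + s) ^ 2 := by positivity
            linarith
          have e3 : (1 + s) ^ μ * massCoeff η ν s * (θ * Real.exp (η * s)) ≤
              (1 + s) ^ μ * η ^ 2 * (θ * Real.exp (η * s)) := by
            have := hs.1
            gcongr
          calc _ ≤ _ := e3
            _ = (1 + s) ^ μ * (θ * (η * (η * Real.exp (η * s)))) := by ring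
            _ ≤ _ := by linarith
        have h3 : ∫ s in (0 : ℝ)..t, (1 + s) ^ μ * massCoeff η ν s * (U s + θ * Real.exp (η * s)) =
            (∫ s in (0 : ℝ)..t, (1 + s) ^ μ * massCoeff η ν s * U s) +
            ∫ s in (0 : ℝ)..t, (1 + s) ^ μ * massCoeff η ν s * (θ * Real.exp (η * s)) := by
          have i1 : IntervalIntegrable (fun s => (1 + s) ^ μ * massCoeff η ν s * U s) volume 0 t :=
            hii (hWc.mul hUc) h0mem ht
          have i2 : IntervalIntegrable
              (fun s => (1 + s) ^ μ * massCoeff η ν s * (θ * Real.exp (η * s))) volume 0 t :=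
            hii (hWc.mul hzc.continuousOn) h0mem ht
          rw [← intervalIntegral.integral_add i1 i2]
          congr 1; ext s; ring
        rw [h3]
        have h4 : (0 : ℝ) ≤ (1 + 0) ^ μ * (θ * (η * Real.exp (η * 0))) := by positivity
        have h5 : (0 : ℝ) ≤ (1 + 0) ^ μ * V 0 := by positivity
        linarith
      · have : 0 < θ * Real.exp (η * 0) := by positivity
        linarith
    intro t ht
    refine le_of_forall_pos_lt_add fun δ hδ => ?_
    have := hθ (δ / Real.exp (η * t)) (by positivity) t ht
    rwa [div_mul_cancel₀ _ (Real.exp_pos _).ne'] at this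
  have hVge : ∀ t ∈ Icc 0 t₁, V 0 ≤ (1 + t) ^ μ * V t := by
    intro t ht
    have h1 := hV 0 h0mem t ht ht.1
    have h2 : 0 ≤ ∫ s in (0 : ℝ)..t, (1 + s) ^ μ * massCoeff η ν s * U s :=
      intervalIntegral.integral_nonneg ht.1 fun s hs => by
        have := hmass s hs.1
        have := hUpos s ⟨hs.1, hs.2.trans ht.2⟩
        have := hw s hs.1
        positivity
    rw [add_zero, Real.one_rpow, one_mul] at h1
    linarith
  have hVpos : ∀ t ∈ Icc 0 t₁, 0 ≤ V t := fun t ht =>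
    nonneg_of_mul_nonneg_right (hV0.trans (hVge t ht)) (by linarith [hw t ht.1])
  have hUmono : MonotoneOn U (Icc 0 t₁) :=
    monotoneOn_Icc_of_hasDerivWithinAt_nonneg hU fun t ht => hVpos t (Ioo_subset_Icc_self ht)
  have h2μ : (0 : ℝ) < 2 ^ (-μ) := by positivity
  have h2μ1 : (2 : ℝ) ^ (-μ) ≤ 1 := Real.rpow_le_one_of_one_le_of_nonpos (by norm_num) (by linarith)
  have h2inv : (2 : ℝ) ^ (-μ) * 2 ^ μ = 1 := by rw [← Real.rpow_add (by norm_num)]; simp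
  -- Either U(0) or V(0) may be zero, but after one unit of time both U and V are at least m. This
  -- is why the comparison with the barrier starts at t = 1.
  set m : ℝ := 2 ^ (-μ) * (U 0 + V 0) with hm
  have hV1 : m ≤ V 1 := by
    have h1 := hV 0 h0mem 1 h1mem zero_le_one
    have h2 : U 0 ≤ ∫ s in (0 : ℝ)..1, (1 + s) ^ μ * massCoeff η ν s * U s := by
      have : ∫ s in (0 : ℝ)..1, U 0 ≤ ∫ s in (0 : ℝ)..1, (1 + s) ^ μ * massCoeff η ν s * U s := by
        refine intervalIntegral.integral_mono_on zero_le_one (by simp)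
          (hii (hWc.mul hUc) h0mem h1mem) fun s hs => ?_
        have hs' : s ∈ Icc 0 t₁ := ⟨hs.1, hs.2.trans ht₁⟩
        have e1 := hUmono h0mem hs' hs.1
        have e2 : 1 ≤ (1 + s) ^ μ * massCoeff η ν s :=
          one_le_mul_of_one_le_of_one_le (hw s hs.1) (hmass s hs.1)
        nlinarith
      simpa using this
    rw [add_zero, Real.one_rpow, one_mul, show (1 : ℝ) + 1 = 2 by norm_num] at h1
    calc m ≤ 2 ^ (-μ) * (2 ^ μ * V 1) := by rw [hm]; gcongr; linarith
      _ = V 1 := by rw [← mul_assoc, h2inv, one_mul]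
  have hU1 : m ≤ U 1 := by
    have hsub : Icc (0 : ℝ) 1 ⊆ Icc 0 t₁ := Icc_subset_Icc_right ht₁
    have hmono : MonotoneOn (fun t => U t - 2 ^ (-μ) * V 0 * t) (Icc 0 1) := by
      refine monotoneOn_Icc_of_hasDerivWithinAt_nonneg (D' := fun t => V t - 2 ^ (-μ) * V 0 * 1)
        (fun t ht => ((hU t (hsub ht)).mono hsub).sub ((hasDerivWithinAt_id t _).const_mul _))
        fun t ht => ?_
      have ht' := hsub (Ioo_subset_Icc_self ht)
      have e1 : (1 + t) ^ μ ≤ 2 ^ μ :=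
        Real.rpow_le_rpow (by linarith [ht.1]) (by linarith [ht.2]) hμ
      have e2 : V 0 ≤ 2 ^ μ * V t :=
        (hVge t ht').trans (mul_le_mul_of_nonneg_right e1 (hVpos t ht'))
      have e3 := mul_le_mul_of_nonneg_left e2 h2μ.le
      rw [← mul_assoc, h2inv, one_mul] at e3
      simp only [mul_one]
      linarith
    have := hmono ⟨le_rfl, zero_le_one⟩ ⟨zero_le_one, le_rfl⟩ zero_le_one
    simp only [mul_zero, sub_zero, mul_one] at this
    have : 2 ^ (-μ) * U 0 ≤ U 0 := mul_le_of_le_one_left hU0 h2μ1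
    rw [hm, mul_add]
    linarith
  intro t ht
  have hm0 : 0 ≤ m := by positivity
  rcases hm0.eq_or_lt with hz | hmpos
  · have : U 0 + V 0 = 0 := by
      rcases mul_eq_zero.1 hz.symm with h | h
      · exact absurd h h2μ.ne'
      · exact h
    rw [this]
    simpa using hVpos t ⟨zero_le_one.trans ht.1, ht.2⟩
  -- Dividing by the sum makes c times the barrier, and c times its derivative, both strictly
  -- smaller than m at t = 1.
  · set c : ℝ := m / (barrier μ η 1 + barrierDeriv μ η 1) with hc
    have hc0 : 0 < c := by positivity
    have hcsum : c * barrier μ η 1 + c * barrierDeriv μ η 1 = m := by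
      rw [hc]; field_simp
    have hsub : Icc (1 : ℝ) t₁ ⊆ Icc 0 t₁ := Icc_subset_Icc_left zero_le_one
    have hbc : ContinuousOn (fun s => c * barrier μ η s) (Icc 0 t₁) := fun s hs =>
      ((hasDerivAt_barrier μ η hs.1).continuousAt.const_mul c |>.continuousWithinAt)
    have hD := (pos_of_second_order_ineq (a := 1) (b := t₁) (D := fun t => U t - c * barrier μ η t)
      (D' := fun t => V t - c * barrierDeriv μ η t)
      (m := fun t => (1 + t) ^ μ) (W := fun t => (1 + t) ^ μ * massCoeff η ν t)
      (fun t ht => ((hU t (hsub ht)).mono hsub).sub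
        ((hasDerivAt_barrier μ η (hsub ht).1).const_mul c).hasDerivWithinAt)
      (fun t ht => by have := hw t (hsub ht).1; linarith)
      (fun t ht => by have := hw t (hsub ht).1; have := hmass t (hsub ht).1; positivity)
      (fun t ht => ?_) ?_).2 t ht
    · have h1 := mul_le_mul_of_nonneg_left
        (barrierDeriv_ge hμ (η := η) (by nlinarith [sq_nonneg ν]) (zero_le_one.trans ht.1)) hc0.le
      have h2 : 2 ^ (-μ) / (barrier μ η 1 + barrierDeriv μ η 1) * (U 0 + V 0) = c := by
        rw [hc, hm]; ring
      rw [h2]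
      linarith
    · have h1 := hV 1 h1mem t (hsub ht) ht.1
      have h2 := mul_le_mul_of_nonneg_left
        (integral_barrier_ge (ν := ν) hμ hη zero_le_one ht.1) hc0.le
      have h3 : ∫ s in (1 : ℝ)..t, (1 + s) ^ μ * massCoeff η ν s * (U s - c * barrier μ η s) =
          (∫ s in (1 : ℝ)..t, (1 + s) ^ μ * massCoeff η ν s * U s) -
          c * ∫ s in (1 : ℝ)..t, (1 + s) ^ μ * massCoeff η ν s * barrier μ η s := by
        rw [← intervalIntegral.integral_const_mul]
        have hi := hii (hWc.mul hbc) h1mem (hsub ht)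
        have hi' : IntervalIntegrable (fun s => c * ((1 + s) ^ μ * massCoeff η ν s * barrier μ η s))
            volume 1 t := by
          refine hi.congr fun s _ => ?_
          simp only [Pi.mul_apply]; ring
        have hu : IntervalIntegrable (fun s => (1 + s) ^ μ * massCoeff η ν s * U s) volume 1 t :=
          hii (hWc.mul hUc) h1mem (hsub ht)
        rw [← intervalIntegral.integral_sub hu hi']
        congr 1; ext s; ring
      rw [h3]
      have h4 : (0 : ℝ) ≤ (1 + 1) ^ μ * (V 1 - c * barrierDeriv μ η 1) := by
        have : 0 < c * barrier μ η 1 := by positivity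
        have : 0 ≤ V 1 - c * barrierDeriv μ η 1 := by linarith
        positivity
      linarith
    · have : 0 < c * barrierDeriv μ η 1 := by positivity
      linarith

/-! ### Blow-up of the functional on a window of times. -/

/-- A function that grows at least quadratically in time with a superlinear dependence on its size
cannot be large at the beginning of the interval `[S, 2 S]`. -/
lemma superlinear_growth_lt_one {q S K h : ℝ} (hq : 1 < q) (hS : 0 < S) (hK : 0 < K) (hh : 0 < h)
    {H : ℝ → ℝ} (hHS : h ≤ H S)
    (hH : ∀ M a b : ℝ, 0 < M → S ≤ a → a ≤ b → b ≤ 2 * S → M ≤ H a →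
      M + K * M ^ q * (b - a) ^ 2 ≤ H b) :
    K * h ^ (q - 1) * (S * (1 - 2 ^ (-((q - 1) / 2)))) ^ 2 < 1 := by
  by_contra! hcon
  -- This θ makes 2^(q-1) θ² = 1. Doubling the size then compensates shrinking the step by θ, so
  -- every step gains the same multiple of the current size, at least 1 by `hcon`. The times t k
  -- stay below 2S while H doubles at each of them.
  set θ : ℝ := 2 ^ (-((q - 1) / 2)) with hθ
  have hθ0 : 0 < θ := by positivity
  have hθ1 : θ < 1 := Real.rpow_lt_one_of_one_lt_of_neg (by norm_num) (by linarith)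
  have hθq : (2 : ℝ) ^ (q - 1) * θ ^ 2 = 1 := by
    rw [hθ, ← Real.rpow_natCast, ← Real.rpow_mul (by norm_num), ← Real.rpow_add (by norm_num)]
    norm_num
  set t : ℕ → ℝ := fun k => S + S * (1 - θ ^ k) with ht
  have hθk : ∀ k : ℕ, 0 < θ ^ k ∧ θ ^ k ≤ 1 := fun k =>
    ⟨by positivity, pow_le_one₀ hθ0.le hθ1.le⟩
  have hSt : ∀ k, S ≤ t k := fun k => by
    have := mul_nonneg hS.le (sub_nonneg.2 (hθk k).2)
    simp only [ht]; linarith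
  have ht2 : ∀ k, t k ≤ 2 * S := fun k => by
    have := mul_pos hS (hθk k).1
    simp only [ht]; linarith
  have hstep : ∀ k : ℕ, t (k + 1) - t k = S * (1 - θ) * θ ^ k := fun k => by
    simp only [ht]; ring
  have hgrow : ∀ k : ℕ, 2 ^ k * h ≤ H (t k) := by
    intro k
    induction k with
    | zero => simpa [ht] using hHS
    | succ k ih =>
      have hM : 0 < 2 ^ k * h := by positivity
      have hle : t k ≤ t (k + 1) := by
        have h1 : 0 ≤ S * (1 - θ) * θ ^ k :=
          mul_nonneg (mul_nonneg hS.le (by linarith)) (hθk k).1.le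
        linarith [hstep k]
      have h1 := hH _ _ _ hM (hSt k) hle (ht2 _) ih
      rw [hstep] at h1
      have h2 : K * (2 ^ k * h) ^ q * (S * (1 - θ) * θ ^ k) ^ 2 =
          (2 ^ k * h) * (K * h ^ (q - 1) * (S * (1 - θ)) ^ 2) := by
        have e1 : (2 ^ k * h) ^ q = (2 ^ k * h) * ((2 ^ (q - 1)) ^ k * h ^ (q - 1)) := by
          have : (2 ^ k * h) ^ q = (2 ^ k * h) ^ (1 + (q - 1)) := by ring_nf
          rw [this, Real.rpow_add hM, Real.rpow_one, Real.mul_rpow (by positivity) hh.le,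
            ← Real.rpow_natCast, ← Real.rpow_natCast, ← Real.rpow_mul (by norm_num),
            ← Real.rpow_mul (by norm_num), mul_comm (k : ℝ)]
        calc _ = (2 ^ k * h) * (K * h ^ (q - 1) * (S * (1 - θ)) ^ 2) *
              ((2 ^ (q - 1)) * θ ^ 2) ^ k := by rw [e1, mul_pow _ (θ ^ 2)]; ring
          _ = _ := by rw [hθq]; simp
      rw [h2] at h1
      have h3 := mul_le_mul_of_nonneg_left hcon hM.le
      rw [pow_succ]
      linarith
  have hb : ∀ k : ℕ, 2 ^ k * h ≤ H (2 * S) := by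
    intro k
    have hM : 0 < 2 ^ k * h := by positivity
    have h1 := hH _ _ _ hM (hSt k) (ht2 k) le_rfl (hgrow k)
    have h2 : 0 ≤ K * (2 ^ k * h) ^ q * (2 * S - t k) ^ 2 := by positivity
    linarith
  obtain ⟨k, hk⟩ := pow_unbounded_of_one_lt (H (2 * S) / h) (one_lt_two : (1 : ℝ) < 2)
  rw [div_lt_iff₀ hh] at hk
  linarith [hb k]

/-- The ratio (1 + s)/S lies between 1/3 and 3 on this window. -/
lemma one_add_rpow_comparable (e : ℝ) {S s : ℝ} (hS : 1 ≤ S) (hs : s ∈ Icc (S / 2) (2 * S)) :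
    3 ^ (-|e|) * S ^ e ≤ (1 + s) ^ e := by
  have hS0 : 0 < S := by linarith
  obtain ⟨h1, h2⟩ := hs
  set x := (1 + s) / S with hx
  have hx1 : 3⁻¹ ≤ x := by rw [hx, le_div_iff₀ hS0]; linarith
  have hx2 : x ≤ 3 := by rw [hx, div_le_iff₀ hS0]; linarith
  have hx0 : 0 < x := by positivity
  have hlog : |Real.log x| ≤ Real.log 3 := by
    rw [abs_le]
    refine ⟨?_, Real.log_le_log hx0 hx2⟩
    rw [← Real.log_inv]
    exact Real.log_le_log (by norm_num) hx1
  have hxe : (3 : ℝ) ^ (-|e|) ≤ x ^ e := by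
    rw [Real.rpow_def_of_pos (by norm_num), Real.rpow_def_of_pos hx0, Real.exp_le_exp]
    have h3 : |Real.log x * e| ≤ Real.log 3 * |e| := by
      rw [abs_mul]; gcongr
    have := neg_abs_le (Real.log x * e)
    linarith
  have : (1 + s) = x * S := by rw [hx]; field_simp
  rw [this, Real.mul_rpow hx0.le hS0.le]
  gcongr

/-- Blow-up estimate on the window `[S / 2, 2 S]` when `Y = (1 + t) ^ (1 + d) * deriv H` has the derivative
`(1 + t) ^ (1 + d - r) n`, where `n` dominates both a fixed power of `1 + t` and a power of `H`. -/
lemma exists_blowup_bound (r d σ γ : ℝ) {q c₁ c₂ : ℝ} (hq : 1 < q) (hc₁ : 0 < c₁) (hc₂ : 0 < c₂) :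
    ∃ L : ℝ, 0 < L ∧ ∀ (S A : ℝ) (H Y n : ℝ → ℝ), 2 ≤ S → 0 < A →
      (∀ t ∈ Icc (S / 2) (2 * S),
        HasDerivWithinAt H (Y t * (1 + t) ^ (-(1 + d))) (Icc (S / 2) (2 * S)) t) →
      0 ≤ H (S / 2) → 0 ≤ Y (S / 2) →
      (∀ a ∈ Icc (S / 2) (2 * S), ∀ b ∈ Icc (S / 2) (2 * S),
        IntervalIntegrable (fun s => (1 + s) ^ (1 + d - r) * n s) volume a b ∧
        Y b - Y a = ∫ s in a..b, (1 + s) ^ (1 + d - r) * n s) →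
      (∀ s, 0 ≤ n s) →
      (∀ᵐ s ∂(volume.restrict (Icc (S / 2) (2 * S))), A * (c₁ * (1 + s) ^ σ) ≤ n s) →
      (∀ᵐ s ∂(volume.restrict (Icc (S / 2) (2 * S))), c₂ * ((1 + s) ^ γ * H s ^ q) ≤ n s) →
      A ^ (q - 1) * S ^ ((q - 1) * (σ + 2 - r) + γ - r + 2) < L := by
  set k : ℝ := 3 ^ (-|1 + d - r|) * 3 ^ (-|-(1 + d)|) / 2 with hk
  have hk0 : 0 < k := by positivity
  set k₁ : ℝ := k * c₁ * 3 ^ (-|σ|) / 4 with hk₁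
  have hk₁0 : 0 < k₁ := by positivity
  set k₂ : ℝ := k * c₂ * 3 ^ (-|γ|) with hk₂
  have hk₂0 : 0 < k₂ := by positivity
  set θ : ℝ := 2 ^ (-((q - 1) / 2)) with hθ
  have hθ1 : θ < 1 := Real.rpow_lt_one_of_one_lt_of_neg (by norm_num) (by linarith)
  have hθ' : 0 < 1 - θ := by linarith
  refine ⟨(k₂ * k₁ ^ (q - 1) * (1 - θ) ^ 2)⁻¹, by positivity, ?_⟩
  intro S A H Y n hS2 hA hH hH0 hY0 hY hn hn₁ hn₂
  have hS0 : 0 < S := by linarith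
  have hS1 : 1 ≤ S := by linarith
  set I := Icc (S / 2) (2 * S) with hI
  have hmemL : S / 2 ∈ I := ⟨le_rfl, by linarith⟩
  have hmemS : S ∈ I := ⟨by linarith, by linarith⟩
  have hYnn : ∀ t ∈ I, 0 ≤ Y t := by
    intro t ht
    have h1 := (hY _ hmemL t ht).2
    have h2 : 0 ≤ ∫ s in (S / 2)..t, (1 + s) ^ (1 + d - r) * n s :=
      intervalIntegral.integral_nonneg ht.1 fun s hs =>
        mul_nonneg (Real.rpow_nonneg (by linarith [hs.1]) _) (hn s)
    linarith
  have hHmono : MonotoneOn H I := monotoneOn_Icc_of_hasDerivWithinAt_nonneg hH fun t ht =>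
    mul_nonneg (hYnn t (Ioo_subset_Icc_self ht)) (Real.rpow_nonneg (by linarith [ht.1]) _)
  -- A lower bound m for n is integrated twice, first to Y and then to H. The weights S^(1+d-r) and
  -- S^(-(1+d)) multiply to S^(-r), so d drops out.
  have key : ∀ a ∈ I, ∀ b ∈ I, a ≤ b → ∀ m : ℝ, 0 ≤ m →
      (∀ᵐ s ∂(volume.restrict (Icc a b)), m ≤ n s) →
      H a + k * m * S ^ (-r) * (b - a) ^ 2 ≤ H b := by
    intro a ha b hb hab m hm hmn
    have hsub : Icc a b ⊆ I := Icc_subset_Icc ha.1 hb.2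
    set w : ℝ := 3 ^ (-|1 + d - r|) * S ^ (1 + d - r) * m with hw
    have hw0 : 0 ≤ w := by positivity
    have hYt : ∀ t ∈ Icc a b, w * (t - a) ≤ Y t := by
      intro t ht
      obtain ⟨i1, i2⟩ := hY a ha t (hsub ht)
      have h1 : ∫ s in a..t, w ≤ ∫ s in a..t, (1 + s) ^ (1 + d - r) * n s := by
        refine intervalIntegral.integral_mono_ae_restrict ht.1 (by simp) i1 ?_
        filter_upwards [ae_restrict_of_ae_restrict_of_subset (Icc_subset_Icc_right ht.2) hmn,
          ae_restrict_mem measurableSet_Icc] with s hs hs'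
        have h2 := one_add_rpow_comparable (1 + d - r) hS1 (hsub ⟨hs'.1, hs'.2.trans ht.2⟩)
        exact mul_le_mul h2 hs hm (Real.rpow_nonneg (by linarith [hs'.1, ha.1]) _)
      rw [intervalIntegral.integral_const, smul_eq_mul] at h1
      linarith [hYnn a ha]
    set z : ℝ := 3 ^ (-|-(1 + d)|) * S ^ (-(1 + d)) with hz
    have hz0 : 0 < z := by positivity
    have hmono : MonotoneOn (fun t => H t - w * z / 2 * (t - a) ^ 2) (Icc a b) := by
      refine monotoneOn_Icc_of_hasDerivWithinAt_nonneg
        (D' := fun t => Y t * (1 + t) ^ (-(1 + d)) - w * z / 2 * (2 * (t - a))) (fun t ht => ?_)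
        fun t ht => ?_
      · refine ((hH t (hsub ht)).mono hsub).sub (HasDerivWithinAt.const_mul _ ?_)
        have := (((hasDerivAt_id t).sub_const a).pow 2).hasDerivWithinAt (s := Icc a b)
        refine this.congr_deriv ?_
        simp
      · have ht' := Ioo_subset_Icc_self ht
        have h1 := hYt t ht'
        have h2 := one_add_rpow_comparable (-(1 + d)) hS1 (hsub ht')
        have h3 : w * (t - a) * z ≤ Y t * (1 + t) ^ (-(1 + d)) :=
          mul_le_mul h1 h2 hz0.le (hYnn t (hsub ht'))
        linarith
    have h1 := hmono ⟨le_rfl, hab⟩ ⟨hab, le_rfl⟩ hab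
    simp only [sub_self] at h1
    have h2 : w * z / 2 = k * m * S ^ (-r) := by
      have : S ^ (-r) = S ^ (1 + d - r) * S ^ (-(1 + d)) := by
        rw [← Real.rpow_add hS0]; ring_nf
      rw [hw, hz, hk, this]; ring
    rw [h2] at h1
    linarith
  -- This is the growth produced by the first lower bound on [S/2, S]. The squared length S²/4
  -- accounts for the 4 in k₁.
  set h : ℝ := k₁ * A * S ^ (σ + 2 - r) with hh
  have hh0 : 0 < h := by positivity
  have hHS : h ≤ H S := by
    have h1 := key _ hmemL _ hmemS (by linarith) (A * (c₁ * (3 ^ (-|σ|) * S ^ σ))) (by positivity) (by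
      filter_upwards [ae_restrict_of_ae_restrict_of_subset
        (Icc_subset_Icc_right (by linarith : S ≤ 2 * S)) hn₁, ae_restrict_mem measurableSet_Icc]
        with s hs hs'
      refine le_trans ?_ hs
      have := one_add_rpow_comparable σ hS1 (⟨hs'.1, by linarith [hs'.2]⟩ : s ∈ I)
      gcongr)
    have h2 : k * (A * (c₁ * (3 ^ (-|σ|) * S ^ σ))) * S ^ (-r) * (S - S / 2) ^ 2 = h := by
      have : S ^ (σ + 2 - r) = S ^ σ * S ^ 2 * S ^ (-r) := by
        rw [← Real.rpow_natCast, ← Real.rpow_add hS0, ← Real.rpow_add hS0]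
        push_cast; ring_nf
      rw [hh, this, hk₁]; ring
    linarith
  have hfin := superlinear_growth_lt_one (K := k₂ * S ^ (γ - r)) hq hS0 (by positivity) hh0 hHS
    (fun M a b hM hSa hab hb hMa => by
      have ha : a ∈ I := ⟨by linarith, by linarith⟩
      have hb' : b ∈ I := ⟨by linarith, hb⟩
      have h1 := key a ha b hb' hab (c₂ * ((3 ^ (-|γ|) * S ^ γ) * M ^ q)) (by positivity) (by
        filter_upwards [ae_restrict_of_ae_restrict_of_subset (Icc_subset_Icc ha.1 hb'.2) hn₂,
          ae_restrict_mem measurableSet_Icc] with s hs hs'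
        refine le_trans ?_ hs
        have hsI : s ∈ I := ⟨ha.1.trans hs'.1, hs'.2.trans hb'.2⟩
        have e1 := one_add_rpow_comparable γ hS1 hsI
        have e2 : M ≤ H s := hMa.trans (hHmono ha hsI hs'.1)
        have e3 : (0 : ℝ) ≤ (1 + s) ^ γ := Real.rpow_nonneg (by linarith [hsI.1]) _
        gcongr)
      have h2 : k * (c₂ * ((3 ^ (-|γ|) * S ^ γ) * M ^ q)) * S ^ (-r) * (b - a) ^ 2 =
          k₂ * S ^ (γ - r) * M ^ q * (b - a) ^ 2 := by
        rw [sub_eq_add_neg γ r, Real.rpow_add hS0, hk₂]; ring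
      linarith)
  rw [lt_inv_comm₀ (by positivity) (by positivity), ← one_div, lt_div_iff₀ (by positivity)]
  refine lt_of_eq_of_lt ?_ hfin
  have e1 : h ^ (q - 1) = k₁ ^ (q - 1) * A ^ (q - 1) * S ^ ((q - 1) * (σ + 2 - r)) := by
    rw [hh, Real.mul_rpow (by positivity) (by positivity), Real.mul_rpow (by positivity) (by positivity),
      ← Real.rpow_mul hS0.le, mul_comm (q - 1)]
  have e2 : S ^ ((q - 1) * (σ + 2 - r) + γ - r + 2) =
      S ^ ((q - 1) * (σ + 2 - r)) * S ^ (γ - r) * S ^ 2 := by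
    rw [← Real.rpow_natCast, ← Real.rpow_add hS0, ← Real.rpow_add hS0]
    push_cast; ring_nf
  rw [e1, e2]; ring

/-! ### Spatial cutoffs, moments and their differential equations. -/

/-- Eigenfunctions and constants are not compactly supported. Multiplied by such a χ they become
admissible, and χ is invisible to a solution supported in the light cone. -/
lemma exists_space_cutoff (N : ℕ) {ρ : ℝ} (hρ : 0 < ρ) :
    ∃ χ : Space N → ℝ, ContDiff ℝ ∞ χ ∧ HasCompactSupport χ ∧ (∀ x, 0 ≤ χ x) ∧
      (∀ x, ‖x‖ < ρ → χ =ᶠ[𝓝 x] fun _ => 1) ∧ ∀ x, ρ + 1 < ‖x‖ → χ x = 0 := by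
  let f : ContDiffBump (0 : Space N) := ⟨ρ, ρ + 1, hρ, by linarith⟩
  refine ⟨f, f.contDiff, f.hasCompactSupport, fun x => f.nonneg, fun x hx => ?_, fun x hx => ?_⟩
  · refine f.eventuallyEq_one_of_mem_ball ?_
    rwa [mem_ball_zero_iff]
  · refine f.zero_of_le_dist ?_
    rw [dist_zero_right]
    exact hx.le

/-- The moment of a square-integrable function against `b`. -/
noncomputable def moment (b : Space N → ℝ) (v : ℝ → LTwo N) (t : ℝ) : ℝ := ∫ x, v t x * b x

/-- The moment of the nonlinearity against `b`. -/
noncomputable def sourceMoment (p q : ℝ) (b : Space N → ℝ) (u ut : ℝ → LTwo N) (t : ℝ) : ℝ :=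
  ∫ x, (|ut t x| ^ p + |u t x| ^ q) * b x

lemma sourceMoment_nonneg (p q : ℝ) {b : Space N → ℝ} (hb : ∀ x, 0 ≤ b x) (u ut : ℝ → LTwo N)
    (t : ℝ) : 0 ≤ sourceMoment p q b u ut t :=
  integral_nonneg fun x => mul_nonneg (by positivity) (hb x)

lemma integral_mul_cutoff {χ φ : Space N → ℝ} {ρ σ : ℝ} (hσ : σ < ρ)
    (hχ : ∀ x, ‖x‖ < ρ → χ =ᶠ[𝓝 x] fun _ => 1) {v : Space N → ℝ}
    (hv : ∀ᵐ x, σ < ‖x‖ → v x = 0) :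
    ∫ x, v x * (χ x * φ x) = ∫ x in Metric.closedBall 0 σ, v x * φ x := by
  rw [← integral_indicator measurableSet_closedBall]
  refine integral_congr_ae ?_
  filter_upwards [hv] with x hx
  by_cases h : ‖x‖ ≤ σ
  · rw [indicator_of_mem (by simpa using h), (hχ x (by linarith)).self_of_nhds, one_mul]
  · rw [indicator_of_notMem (by simpa using h), hx (by linarith), zero_mul]

/-- Where v is nonzero, χ is 1 on a neighbourhood, so no derivative of χ contributes. The strict
inequality σ < ρ provides the neighbourhood. -/
lemma integral_mul_coordLaplacian_cutoff {χ φ : Space N → ℝ} {ρ σ κ : ℝ} (hσ : σ < ρ)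
    (hχ : ∀ x, ‖x‖ < ρ → χ =ᶠ[𝓝 x] fun _ => 1) (hφ : ∀ x, coordLaplacian φ x = κ * φ x)
    {v : Space N → ℝ} (hv : ∀ᵐ x, σ < ‖x‖ → v x = 0) :
    ∫ x, v x * coordLaplacian (fun x => χ x * φ x) x = κ * ∫ x, v x * (χ x * φ x) := by
  rw [← integral_const_mul]
  refine integral_congr_ae ?_
  filter_upwards [hv] with x hx
  by_cases h : ‖x‖ ≤ σ
  · have h1 := hχ x (by linarith)
    have h2 : (fun x => χ x * φ x) =ᶠ[𝓝 x] φ := by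
      filter_upwards [h1] with y hy
      rw [hy, one_mul]
    rw [coordLaplacian_congr h2, hφ, h1.self_of_nhds]
    ring
  · rw [hx (by linarith)]; ring

lemma coordLaplacian_const (c : ℝ) (x : Space N) : coordLaplacian (fun _ : Space N => c) x = 0 := by
  unfold coordLaplacian
  refine Finset.sum_eq_zero fun i _ => ?_
  simp

/-- The ordinary differential equation for the moments against an eigenfunction of the Laplacian,
with an integrating factor, in integrated form. -/
lemma IsEnergySolution.moment_identity {μ ν p q ε R : ℝ} {f g : Space N → ℝ} {T : EReal}
    {u ut : ℝ → LTwo N} {Du : ℝ → LTwoVec N} (h : IsEnergySolution μ ν p q ε f g T u ut Du)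
    (hsupp : ∀ t ∈ timeInterval T, ∀ᵐ x, t + R < ‖x‖ → u t x = 0)
    {t₁ ρ κ : ℝ} (ht₁ : t₁ ∈ timeInterval T) (hρ : t₁ + R < ρ) {χ φ : Space N → ℝ}
    (hχ : ContDiff ℝ ∞ χ) (hχc : HasCompactSupport χ)
    (hχ1 : ∀ x, ‖x‖ < ρ → χ =ᶠ[𝓝 x] fun _ => 1) (hφ : ContDiff ℝ ∞ φ)
    (hφκ : ∀ x, coordLaplacian φ x = κ * φ x) (e : ℝ) {s t : ℝ} (hs : s ∈ Icc 0 t₁)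
    (ht : t ∈ Icc 0 t₁) :
    IntervalIntegrable (fun τ => (1 + τ) ^ e * sourceMoment p q (fun x => χ x * φ x) u ut τ)
      volume s t ∧
    (1 + t) ^ e * moment (fun x => χ x * φ x) ut t - (1 + s) ^ e * moment (fun x => χ x * φ x) ut s =
      (∫ τ in s..t, ((e - μ) * (1 + τ) ^ (e - 1) * moment (fun x => χ x * φ x) ut τ +
        (κ * (1 + τ) ^ e - ν ^ 2 * (1 + τ) ^ (e - 2)) * moment (fun x => χ x * φ x) u τ)) +
      ∫ τ in s..t, (1 + τ) ^ e * sourceMoment p q (fun x => χ x * φ x) u ut τ := by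
  have hb := hχ.mul hφ
  have hbc : HasCompactSupport fun x => χ x * φ x := hχc.mul_right
  set b : Space N → ℝ := fun x => χ x * φ x with hbdef
  have hsub := Icc_subset_timeInterval ht₁
  set k : ℝ → ℝ := fun τ => (e - μ) * (1 + τ) ^ (e - 1) * moment b ut τ +
        (κ * (1 + τ) ^ e - ν ^ 2 * (1 + τ) ^ (e - 2)) * moment b u τ with hk
  have hkc : ContinuousOn k (Icc 0 t₁) :=
    ((continuousOn_const.mul (continuousOn_one_add_rpow _ _)).mul
      ((continuousOn_pairing hb.continuous hbc h.continuousOn_ut).mono hsub)).add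
    (((continuousOn_const.mul (continuousOn_one_add_rpow _ _)).sub
      (continuousOn_const.mul (continuousOn_one_add_rpow _ _))).mul
      ((continuousOn_pairing hb.continuous hbc h.continuousOn_u).mono hsub))
  -- The weak formulation concerns intervals starting at 0, so the identity on [s, t] is obtained as
  -- a difference of two such identities.
  have main : ∀ r ∈ Icc 0 t₁, IntervalIntegrable (fun τ => (1 + τ) ^ e * sourceMoment p q b u ut τ)
      volume 0 r ∧ (1 + r) ^ e * moment b ut r - moment b ut 0 =
      (∫ τ in (0 : ℝ)..r, k τ) + ∫ τ in (0 : ℝ)..r, (1 + τ) ^ e * sourceMoment p q b u ut τ := by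
    intro r hr
    obtain ⟨h1, h2⟩ := h.weighted_identity hb hbc e (hsub hr)
    refine ⟨h1, h2.trans ?_⟩
    congr 1
    refine intervalIntegral.integral_congr fun τ hτ => ?_
    rw [uIcc_of_le hr.1] at hτ
    have hτ' : τ ∈ Icc 0 t₁ := ⟨hτ.1, hτ.2.trans hr.2⟩
    have h3 := integral_mul_coordLaplacian_cutoff (lt_of_le_of_lt (by linarith [hτ'.2]) hρ) hχ1 hφκ
      (hsupp τ (hsub hτ'))
    simp only [hk, moment]
    rw [h3]
    ring
  obtain ⟨i1, e1⟩ := main s hs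
  obtain ⟨i2, e2⟩ := main t ht
  refine ⟨i1.symm.trans i2, ?_⟩
  have hki : ∀ r ∈ Icc 0 t₁, IntervalIntegrable k volume 0 r := fun r hr =>
    (hkc.mono (by rw [uIcc_of_le hr.1]; exact Icc_subset_Icc_right hr.2)).intervalIntegrable
  rw [← intervalIntegral.integral_interval_sub_left (hki t ht) (hki s hs),
    ← intervalIntegral.integral_interval_sub_left i2 i1]
  linarith

lemma IsEnergySolution.hasDerivWithinAt_moment {μ ν p q ε : ℝ} {f g : Space N → ℝ} {T : EReal}
    {u ut : ℝ → LTwo N} {Du : ℝ → LTwoVec N} (h : IsEnergySolution μ ν p q ε f g T u ut Du)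
    {t₁ : ℝ} (ht₁ : t₁ ∈ timeInterval T) {b : Space N → ℝ} (hb : ContDiff ℝ ∞ b)
    (hbc : HasCompactSupport b) {t : ℝ} (ht : t ∈ Icc 0 t₁) :
    HasDerivWithinAt (moment b u) (moment b ut t) (Icc 0 t₁) t :=
  hasDerivWithinAt_pairing hb.continuous hbc ((h.hasDerivWithinAt t
    (Icc_subset_timeInterval ht₁ ht)).mono (Icc_subset_timeInterval ht₁))

/-- The cone widens with time, so all earlier slices vanish outside the ball of radius t + R. The
derivative, a limit of left difference quotients, does too. -/
lemma IsEnergySolution.ae_zero_ut {μ ν p q ε R : ℝ} {f g : Space N → ℝ} {T : EReal}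
    {u ut : ℝ → LTwo N} {Du : ℝ → LTwoVec N} (h : IsEnergySolution μ ν p q ε f g T u ut Du)
    (hsupp : ∀ t ∈ timeInterval T, ∀ᵐ x, t + R < ‖x‖ → u t x = 0) {t : ℝ} (ht0 : 0 < t)
    (ht : t ∈ timeInterval T) : ∀ᵐ x, t + R < ‖x‖ → ut t x = 0 := by
  have hsub := Icc_subset_timeInterval ht
  refine ae_zero_of_hasDerivWithinAt (P := fun x => t + R < ‖x‖) ht0 (fun s hs => ?_)
    ((h.hasDerivWithinAt t ht).mono hsub)
  filter_upwards [hsupp s (hsub hs)] with x hx hP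
  exact hx (by linarith [hs.2])

/-- Integrability on the larger ball, which contains the support of χ, is essential: otherwise the
integral defining `sourceMoment` could take its default value 0 and the bound could fail. -/
lemma setIntegral_rpow_le_sourceMoment {p q : ℝ} {u ut : ℝ → LTwo N} {χ : Space N → ℝ} {ρ σ t : ℝ}
    (hχ : ContDiff ℝ ∞ χ) (hχ0 : ∀ x, 0 ≤ χ x) (hχ1 : ∀ x, ‖x‖ < ρ → χ =ᶠ[𝓝 x] fun _ => 1)
    (hχz : ∀ x, ρ + 1 < ‖x‖ → χ x = 0) (hσ : σ < ρ)
    (hp : IntegrableOn (fun x => |ut t x| ^ p) (Metric.closedBall 0 (ρ + 1)))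
    (hq : IntegrableOn (fun x => |u t x| ^ q) (Metric.closedBall 0 (ρ + 1))) :
    ∫ x in Metric.closedBall 0 σ, |ut t x| ^ p ≤ sourceMoment p q (fun x => χ x * 1) u ut t ∧
    ∫ x in Metric.closedBall 0 σ, |u t x| ^ q ≤ sourceMoment p q (fun x => χ x * 1) u ut t := by
  have hF : IntegrableOn (fun x => |ut t x| ^ p + |u t x| ^ q) (Metric.closedBall 0 (ρ + 1)) :=
    hp.add hq
  have hFχ : IntegrableOn (fun x => (|ut t x| ^ p + |u t x| ^ q) * (χ x * 1))
      (Metric.closedBall 0 (ρ + 1)) :=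
    hF.mul_continuousOn (hχ.continuous.mul continuous_const).continuousOn (isCompact_closedBall _ _)
  have hint : Integrable (fun x => (|ut t x| ^ p + |u t x| ^ q) * (χ x * 1)) := by
    rwa [← integrableOn_iff_integrable_of_support_subset]
    intro x hx
    by_contra hn
    rw [Metric.mem_closedBall, dist_zero_right, not_le] at hn
    exact hx (by simp [hχz x hn])
  have hsub : Metric.closedBall (0 : Space N) σ ⊆ Metric.closedBall 0 (ρ + 1) :=
    Metric.closedBall_subset_closedBall (by linarith)
  have h1 : ∫ x in Metric.closedBall 0 σ, (|ut t x| ^ p + |u t x| ^ q) ≤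
      sourceMoment p q (fun x => χ x * 1) u ut t := by
    refine le_trans (le_of_eq ?_) (setIntegral_le_integral (s := Metric.closedBall 0 σ) hint
      (Eventually.of_forall fun x => mul_nonneg (by positivity) (by simpa using hχ0 x)))
    refine setIntegral_congr_fun measurableSet_closedBall fun x hx => ?_
    rw [Metric.mem_closedBall, dist_zero_right] at hx
    simp only
    rw [(hχ1 x (by linarith)).self_of_nhds]; ring
  constructor
  · refine le_trans ?_ h1
    exact setIntegral_mono (hp.mono_set hsub) (hF.mono_set hsub) fun x =>
      le_add_of_nonneg_right (by positivity)
  · refine le_trans ?_ h1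
    exact setIntegral_mono (hq.mono_set hsub) (hF.mono_set hsub) fun x =>
      le_add_of_nonneg_left (by positivity)

lemma abs_moment_rpow_le {p : ℝ} (hp : 1 < p) {v : ℝ → LTwo N} {χ φ : Space N → ℝ} {ρ σ t : ℝ}
    (hχ1 : ∀ x, ‖x‖ < ρ → χ =ᶠ[𝓝 x] fun _ => 1) (hσ : σ < ρ) (hφ : Continuous φ)
    (hv : ∀ᵐ x, σ < ‖x‖ → v t x = 0)
    (hvp : IntegrableOn (fun x => |v t x| ^ p) (Metric.closedBall 0 σ)) :
    |moment (fun x => χ x * φ x) v t| ^ p ≤ (∫ x in Metric.closedBall 0 σ, |v t x| ^ p) *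
      (∫ x in Metric.closedBall 0 σ, |φ x| ^ (p / (p - 1))) ^ (p - 1) := by
  have h := integral_mul_cutoff (φ := φ) hσ hχ1 hv
  unfold moment
  rw [h]
  have hp1 : 0 < p - 1 := by linarith
  refine abs_integral_mul_rpow_le hp (Lp.stronglyMeasurable _).aestronglyMeasurable
    hφ.aestronglyMeasurable hvp ?_
  exact (hφ.abs.rpow_const fun x => Or.inr (by positivity)).continuousOn.integrableOn_compact
    (isCompact_closedBall _ _)

lemma one_add_add_rpow_le {R s : ℝ} (hR : 0 ≤ R) (hs : 0 ≤ s) (e : ℝ) :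
    (1 + (s + R)) ^ e ≤ (1 + R) ^ |e| * (1 + s) ^ e := by
  rcases le_total 0 e with h | h
  · rw [abs_of_nonneg h, ← Real.mul_rpow (by linarith) (by linarith)]
    refine Real.rpow_le_rpow (by linarith) ?_ h
    nlinarith
  · have h1 : (1 + (s + R)) ^ e ≤ (1 + s) ^ e :=
      Real.rpow_le_rpow_of_nonpos (by linarith) (by linarith) h
    refine h1.trans (le_mul_of_one_le_left (by positivity) ?_)
    exact Real.one_le_rpow (by linarith) (abs_nonneg _)

lemma integrableOn_mul_of_memLp {f φ : Space N → ℝ} (hf : MemLp f 2 volume) (hφ : Continuous φ)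
    (r : ℝ) : IntegrableOn (fun x => f x * φ x) (Metric.closedBall 0 r) :=
  ((hf.locallyIntegrable (by norm_num)).integrableOn_isCompact
    (isCompact_closedBall _ _)).mul_continuousOn hφ.continuousOn (isCompact_closedBall _ _)

lemma ae_zero_of_setIntegral_mul_eq_zero {f φ : Space N → ℝ} {R : ℝ} (hf : MemLp f 2 volume)
    (hφ : Continuous φ) (hφ1 : ∀ x, 1 ≤ φ x) (hf0 : ∀ᵐ x, 0 ≤ f x)
    (hsupp : ∀ᵐ x, R ≤ ‖x‖ → f x = 0) (h : ∫ x in Metric.closedBall 0 R, f x * φ x = 0) :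
    ∀ᵐ x, f x = 0 := by
  rw [setIntegral_eq_zero_iff_of_nonneg_ae (ae_restrict_of_ae (by
    filter_upwards [hf0] with x hx using mul_nonneg hx (zero_le_one.trans (hφ1 x))))
    (integrableOn_mul_of_memLp hf hφ R)] at h
  have h' := (ae_restrict_iff' measurableSet_closedBall).1 h
  filter_upwards [h', hsupp] with x hx hs
  by_cases hR : R ≤ ‖x‖
  · exact hs hR
  · have h1 := hx (by rw [Metric.mem_closedBall, dist_zero_right]; linarith)
    exact (mul_eq_zero.1 h1).resolve_right (by linarith [hφ1 x])

lemma moment_initial {R ρ ε : ℝ} {f : Space N → ℝ} {u : ℝ → LTwo N} {χ φ : Space N → ℝ} (hρ : R < ρ)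
    (hχ1 : ∀ x, ‖x‖ < ρ → χ =ᶠ[𝓝 x] fun _ => 1) (hu : ∀ᵐ x, u 0 x = ε * f x)
    (hf : ∀ᵐ x, R ≤ ‖x‖ → f x = 0) :
    moment (fun x => χ x * φ x) u 0 = ε * ∫ x in Metric.closedBall 0 R, f x * φ x := by
  unfold moment
  rw [integral_mul_cutoff hρ hχ1 (by
    filter_upwards [hu, hf] with x h1 h2 h3
    rw [h1, h2 h3.le, mul_zero]), ← integral_const_mul]
  refine integral_congr_ae (ae_restrict_of_ae ?_)
  filter_upwards [hu] with x hx
  rw [hx]; ring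

lemma rpow_mul_exp_rpow {a : ℝ} (ha : 0 < a) (x y z : ℝ) :
    (a ^ x * Real.exp y) ^ z = a ^ (x * z) * Real.exp (y * z) := by
  rw [Real.mul_rpow (by positivity) (by positivity), ← Real.rpow_mul ha.le, Real.exp_mul]

/-! ### The two lower bounds for the nonlinearity. -/

/-- The nonlinearity dominates a power of `1 + t` because the moment of `u_t` against the radial
eigenfunction grows exponentially. -/
lemma exists_sourceMoment_ge_rpow (hN : 1 ≤ N) {R μ ν p q : ℝ} (hR : 0 < R) (hμ : 0 ≤ μ) (hp : 1 < p)
    (hq : 1 < q) {f g : Space N → ℝ} (hf : MemLp f 2 volume) (hg : MemLp g 2 volume)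
    (hf_nonneg : ∀ᵐ x, 0 ≤ f x) (hg_nonneg : ∀ᵐ x, 0 ≤ g x)
    (hf_supp : ∀ᵐ x, R ≤ ‖x‖ → f x = 0) (hg_supp : ∀ᵐ x, R ≤ ‖x‖ → g x = 0)
    (hfg_ne : ¬ ((∀ᵐ x, f x = 0) ∧ (∀ᵐ x, g x = 0))) :
    ∃ c : ℝ, 0 < c ∧ ∀ (ε : ℝ) (T : EReal) (u ut : ℝ → LTwo N) (Du : ℝ → LTwoVec N),
      0 < ε → IsEnergySolution μ ν p q ε f g T u ut Du →
      (∀ t ∈ timeInterval T, ∀ᵐ x, t + R < ‖x‖ → u t x = 0) →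
      ∀ (t₁ ρ : ℝ) (χ : Space N → ℝ), 1 ≤ t₁ → t₁ ∈ timeInterval T → t₁ + R < ρ →
      ContDiff ℝ ∞ χ → HasCompactSupport χ → (∀ x, 0 ≤ χ x) →
      (∀ x, ‖x‖ < ρ → χ =ᶠ[𝓝 x] fun _ => 1) → (∀ x, ρ + 1 < ‖x‖ → χ x = 0) →
      ∀ᵐ s ∂(volume.restrict (Icc 1 t₁)),
        ε ^ p * (c * (1 + s) ^ ((N : ℝ) - 1 - ((N : ℝ) - 1 + μ) * p / 2)) ≤
          sourceMoment p q (fun x => χ x * 1) u ut s := by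
  -- Large enough for the barrier to be a subsolution and for the mass term to be dominated. The
  -- value does not affect the resulting power of 1 + s.
  set η : ℝ := 2 + μ + ν ^ 2 with hη
  have hη1 : 1 ≤ η := by nlinarith [sq_nonneg ν]
  have hη0 : 0 < η := by linarith
  set φ : Space N → ℝ := radialEigen N η with hφ
  have hφs : ContDiff ℝ ∞ φ := contDiff_radialEigen hN η
  have hφ1 : ∀ x, 1 ≤ φ x := one_le_radialEigen hN η
  have hp1 : 0 < p - 1 := by linarith
  obtain ⟨c₀, hc₀, hexp⟩ := exists_exponential_lower_bound (ν := ν) (η := η) hμ le_rfl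
  obtain ⟨D, hD, hint⟩ := exists_integral_radialEigen_rpow_le hN hη1 (c := p / (p - 1)) (by positivity)
  set Df : ℝ := ∫ x in Metric.closedBall 0 R, f x * φ x with hDf
  set Dg : ℝ := ∫ x in Metric.closedBall 0 R, g x * φ x with hDg
  have hDf0 : 0 ≤ Df := setIntegral_nonneg_of_ae (by
    filter_upwards [hf_nonneg] with x hx using mul_nonneg hx (zero_le_one.trans (hφ1 x)))
  have hDg0 : 0 ≤ Dg := setIntegral_nonneg_of_ae (by
    filter_upwards [hg_nonneg] with x hx using mul_nonneg hx (zero_le_one.trans (hφ1 x)))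
  have hDpos : 0 < Df + Dg := by
    by_contra! hcon
    have h1 : Df = 0 := by linarith
    have h2 : Dg = 0 := by linarith
    exact hfg_ne ⟨ae_zero_of_setIntegral_mul_eq_zero hf hφs.continuous hφ1 hf_nonneg hf_supp h1,
      ae_zero_of_setIntegral_mul_eq_zero hg hφs.continuous hφ1 hg_nonneg hg_supp h2⟩
  set m : ℝ := (N : ℝ) - 1 with hm
  set k : ℝ := m * (1 - p / (p - 1) / 2) with hk
  set D' : ℝ := D * ((1 + R) ^ |k| * Real.exp (p / (p - 1) * η * R)) with hD'
  have hD'0 : 0 < D' := by positivity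
  refine ⟨(c₀ * (Df + Dg)) ^ p / D' ^ (p - 1), by positivity, ?_⟩
  intro ε T u ut Du hε h hsupp t₁ ρ χ ht1 ht₁ hρ hχ hχc hχ0 hχ1 hχz
  have hsub := Icc_subset_timeInterval ht₁
  have hb0 : ∀ x, 0 ≤ χ x * φ x := fun x => mul_nonneg (hχ0 x) (zero_le_one.trans (hφ1 x))
  have hU0 : moment (fun x => χ x * φ x) u 0 = ε * Df :=
    moment_initial (by linarith) hχ1 h.initial_u hf_supp
  have hV0 : moment (fun x => χ x * φ x) ut 0 = ε * Dg :=
    moment_initial (by linarith) hχ1 h.initial_ut hg_supp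
  -- The integrating factor (1+t)^μ removes the damping term, and the nonnegative source is
  -- discarded to get the required inequality.
  have hlow := hexp t₁ (moment (fun x => χ x * φ x) u) (moment (fun x => χ x * φ x) ut) ht1
    (fun t ht => h.hasDerivWithinAt_moment ht₁ (hχ.mul hφs) hχc.mul_right ht)
    (fun s hs t ht hst => by
      obtain ⟨-, e1⟩ := h.moment_identity hsupp ht₁ hρ hχ hχc hχ1 hφs
        (coordLaplacian_radialEigen hN η) μ hs ht
      have e2 : 0 ≤ ∫ τ in s..t, (1 + τ) ^ μ * sourceMoment p q (fun x => χ x * φ x) u ut τ :=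
        intervalIntegral.integral_nonneg hst fun τ hτ =>
          mul_nonneg (Real.rpow_nonneg (by linarith [hτ.1, hs.1]) _) (sourceMoment_nonneg p q hb0 _ _ _)
      rw [e1]
      refine le_trans (le_of_eq ?_) (le_add_of_nonneg_right e2)
      refine intervalIntegral.integral_congr fun τ hτ => ?_
      rw [uIcc_of_le hst] at hτ
      have hτ0 : 0 < 1 + τ := by linarith [hs.1, hτ.1]
      simp only [massCoeff]
      have hpow : (1 + τ) ^ (μ - 2) = (1 + τ) ^ μ / (1 + τ) ^ 2 := by
        rw [Real.rpow_sub hτ0, Real.rpow_ofNat]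
      rw [hpow]
      ring)
    (by rw [hU0]; positivity) (by rw [hV0]; positivity)
  -- Local integrability says nothing down to time 0, hence the restriction to s ≥ 1, where the
  -- exponential bound is available as well.
  have hae1 := h.memLpLoc_ut.ae_integrableOn (by linarith) h.continuousOn_ut one_pos ht₁ (ρ + 1)
  have hae2 := h.memLpLoc_u.ae_integrableOn (by linarith) h.continuousOn_u one_pos ht₁ (ρ + 1)
  filter_upwards [hae1, hae2, ae_restrict_mem measurableSet_Icc] with s hs1 hs2 hs
  have hs0 : 0 < s := by linarith [hs.1]
  have hsR : s + R < ρ := by linarith [hs.2]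
  set I := ∫ x in Metric.closedBall (0 : Space N) (s + R), |ut s x| ^ p with hI
  set J := ∫ x in Metric.closedBall (0 : Space N) (s + R), |φ x| ^ (p / (p - 1)) with hJ
  have hIle : I ≤ sourceMoment p q (fun x => χ x * 1) u ut s :=
    (setIntegral_rpow_le_sourceMoment hχ hχ0 hχ1 hχz hsR hs1 hs2).1
  have hI0 : 0 ≤ I := integral_nonneg fun x => by positivity
  have hJ0 : 0 ≤ J := integral_nonneg fun x => by positivity
  have hH := abs_moment_rpow_le hp (v := ut) (t := s) (φ := φ) hχ1 hsR hφs.continuous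
    (h.ae_zero_ut hsupp hs0 (hsub ⟨hs0.le, hs.2⟩))
    (hs1.mono_set (Metric.closedBall_subset_closedBall (by linarith)))
  have hJle : J ≤ D' * ((1 + s) ^ k * Real.exp (p / (p - 1) * η * s)) := by
    have e1 : J = ∫ x in Metric.closedBall (0 : Space N) (s + R), radialEigen N η x ^ (p / (p - 1)) := by
      refine integral_congr_ae (Eventually.of_forall fun x => ?_)
      simp only
      rw [abs_of_nonneg (zero_le_one.trans (hφ1 x))]
    rw [e1]
    refine (hint (s + R) (by linarith)).trans ?_
    have e2 := one_add_add_rpow_le hR.le hs0.le k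
    calc D * ((1 + (s + R)) ^ k * Real.exp (p / (p - 1) * η * (s + R)))
        ≤ D * (((1 + R) ^ |k| * (1 + s) ^ k) * Real.exp (p / (p - 1) * η * (s + R))) := by gcongr
      _ = _ := by rw [hD', mul_add, Real.exp_add]; ring
  set X : ℝ := c₀ * (ε * Df + ε * Dg) * ((1 + s) ^ (-μ / 2) * Real.exp (η * s)) with hX
  have hX0 : 0 ≤ X := by positivity
  have hXV : X ≤ |moment (fun x => χ x * φ x) ut s| := by
    have := hlow s hs
    rw [hU0, hV0] at this
    exact this.trans (le_abs_self _)
  have hXI : X ^ p ≤ I * (D' * ((1 + s) ^ k * Real.exp (p / (p - 1) * η * s))) ^ (p - 1) :=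
    (Real.rpow_le_rpow hX0 hXV (by linarith)).trans (hH.trans (by gcongr))
  have hs1' : 0 < 1 + s := by linarith
  refine le_trans ?_ hIle
  have hW : 0 < (D' * ((1 + s) ^ k * Real.exp (p / (p - 1) * η * s))) ^ (p - 1) := by positivity
  refine le_of_mul_le_mul_right (le_trans (le_of_eq ?_) hXI) hW
  have e1 : X ^ p = (ε ^ p * (c₀ * (Df + Dg)) ^ p) * ((1 + s) ^ (-μ / 2 * p) * Real.exp (η * s * p)) := by
    rw [hX, show c₀ * (ε * Df + ε * Dg) = ε * (c₀ * (Df + Dg)) by ring,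
      Real.mul_rpow (by positivity) (by positivity), rpow_mul_exp_rpow hs1',
      Real.mul_rpow hε.le (by positivity)]
  -- Raising the conjugate-exponent integral to the power p - 1 gives e^(pηs), which is the same
  -- exponential as in X^p. Only powers of 1 + s remain.
  have e2 : (D' * ((1 + s) ^ k * Real.exp (p / (p - 1) * η * s))) ^ (p - 1) =
      D' ^ (p - 1) * ((1 + s) ^ (k * (p - 1)) * Real.exp (η * s * p)) := by
    rw [Real.mul_rpow hD'0.le (by positivity), rpow_mul_exp_rpow hs1']
    congr 3
    field_simp
  have e3 : (1 + s) ^ (m - (m + μ) * p / 2) * (1 + s) ^ (k * (p - 1)) = (1 + s) ^ (-μ / 2 * p) := by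
    rw [← Real.rpow_add hs1']
    congr 1
    rw [hk]; field_simp; ring
  rw [e1, e2, ← e3]
  field_simp

/-- The nonlinearity dominates a power of the mean of `u`. -/
lemma exists_sourceMoment_ge_moment {R μ ν p q : ℝ} (hR : 0 < R) (hp : 1 < p)
    (hq : 1 < q) {f g : Space N → ℝ} :
    ∃ c : ℝ, 0 < c ∧ ∀ (ε : ℝ) (T : EReal) (u ut : ℝ → LTwo N) (Du : ℝ → LTwoVec N),
      IsEnergySolution μ ν p q ε f g T u ut Du →
      (∀ t ∈ timeInterval T, ∀ᵐ x, t + R < ‖x‖ → u t x = 0) →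
      ∀ (t₁ ρ : ℝ) (χ : Space N → ℝ), t₁ ∈ timeInterval T → t₁ + R < ρ →
      ContDiff ℝ ∞ χ → (∀ x, 0 ≤ χ x) →
      (∀ x, ‖x‖ < ρ → χ =ᶠ[𝓝 x] fun _ => 1) → (∀ x, ρ + 1 < ‖x‖ → χ x = 0) →
      ∀ᵐ s ∂(volume.restrict (Icc 1 t₁)),
        c * ((1 + s) ^ (-((N : ℝ) * (q - 1))) * |moment (fun x => χ x * 1) u s| ^ q) ≤
          sourceMoment p q (fun x => χ x * 1) u ut s := by
  have hq1 : 0 < q - 1 := by linarith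
  set κ : ℝ := volume.real (Metric.closedBall (0 : Space N) 1) with hκ
  have hκ0 : 0 < κ := by
    refine ENNReal.toReal_pos ?_ (isCompact_closedBall _ _).measure_lt_top.ne
    exact (Metric.measure_closedBall_pos volume _ one_pos).ne'
  refine ⟨((κ * (1 + R) ^ N) ^ (q - 1))⁻¹, by positivity, ?_⟩
  intro ε T u ut Du h hsupp t₁ ρ χ ht₁ hρ hχ hχ0 hχ1 hχz
  have hsub := Icc_subset_timeInterval ht₁
  have hae1 := h.memLpLoc_ut.ae_integrableOn (by linarith) h.continuousOn_ut one_pos ht₁ (ρ + 1)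
  have hae2 := h.memLpLoc_u.ae_integrableOn (by linarith) h.continuousOn_u one_pos ht₁ (ρ + 1)
  filter_upwards [hae1, hae2, ae_restrict_mem measurableSet_Icc] with s hs1 hs2 hs
  have hs0 : 0 < s := by linarith [hs.1]
  have hsR : s + R < ρ := by linarith [hs.2]
  have hIle := (setIntegral_rpow_le_sourceMoment hχ hχ0 hχ1 hχz hsR hs1 hs2).2
  have hH := abs_moment_rpow_le hq (v := u) (t := s) (φ := fun _ => 1) hχ1 hsR continuous_const
    (hsupp s (hsub ⟨hs0.le, hs.2⟩))
    (hs2.mono_set (Metric.closedBall_subset_closedBall (by linarith)))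
  set I := ∫ x in Metric.closedBall (0 : Space N) (s + R), |u s x| ^ q with hI
  have hI0 : 0 ≤ I := integral_nonneg fun x => by positivity
  -- Hölder's inequality against the constant 1 costs the volume of the ball, of order (1+s)^N, to
  -- the power q - 1.
  have hvol : ∫ x in Metric.closedBall (0 : Space N) (s + R), |(1 : ℝ)| ^ (q / (q - 1)) ≤
      κ * (1 + R) ^ N * (1 + s) ^ (N : ℝ) := by
    simp only [abs_one, Real.one_rpow, integral_const, smul_eq_mul, mul_one]
    rw [measureReal_restrict_apply_univ, Measure.real, Measure.addHaar_closedBall' _ _ (by linarith)]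
    rw [ENNReal.toReal_mul, ENNReal.toReal_ofReal (by positivity), Real.rpow_natCast]
    have h1 : (s + R) ^ N ≤ (1 + R) ^ N * (1 + s) ^ N := by
      rw [← mul_pow]
      refine pow_le_pow_left₀ (by linarith) ?_ N
      nlinarith
    rw [show Module.finrank ℝ (Space N) = N by simp]
    calc (s + R) ^ N * κ ≤ ((1 + R) ^ N * (1 + s) ^ N) * κ := by gcongr
      _ = _ := by ring
  have hs1' : 0 < 1 + s := by linarith
  have h2 : |moment (fun x => χ x * 1) u s| ^ q ≤
      I * (κ * (1 + R) ^ N * (1 + s) ^ (N : ℝ)) ^ (q - 1) := by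
    refine hH.trans ?_
    gcongr
  refine le_trans ?_ hIle
  rw [Real.mul_rpow (by positivity) (by positivity), ← Real.rpow_mul hs1'.le] at h2
  calc _ ≤ ((κ * (1 + R) ^ N) ^ (q - 1))⁻¹ * ((1 + s) ^ (-((N : ℝ) * (q - 1))) *
        (I * ((κ * (1 + R) ^ N) ^ (q - 1) * (1 + s) ^ ((N : ℝ) * (q - 1))))) := by gcongr
    _ = I := by rw [Real.rpow_neg hs1'.le]; field_simp

/-! ### The mean of the solution. -/

/-- The characteristic exponents of the Euler equation are r and r - √δ, and their product is ν². -/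
lemma char_exponent_eq {μ ν r : ℝ} (hδ : 0 ≤ delta μ ν)
    (hr : r = (1 - μ + Real.sqrt (delta μ ν)) / 2) :
    r * (Real.sqrt (delta μ ν) - r) = -ν ^ 2 := by
  have h := Real.sq_sqrt hδ
  unfold delta at *
  rw [hr]
  nlinarith

/-- Writing the mean of the solution as `(1 + t) ^ r H`, the function `(1 + t) ^ (1 + √δ) * deriv H` has the
derivative `(1 + t) ^ (1 + √δ - r) n`, where `n` is the integral of the nonlinearity. -/
lemma IsEnergySolution.mean_identity {μ ν p q ε R r : ℝ} {f g : Space N → ℝ} {T : EReal}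
    {u ut : ℝ → LTwo N} {Du : ℝ → LTwoVec N} (h : IsEnergySolution μ ν p q ε f g T u ut Du)
    (hδ : 0 ≤ delta μ ν) (hr : r = (1 - μ + Real.sqrt (delta μ ν)) / 2)
    (hsupp : ∀ t ∈ timeInterval T, ∀ᵐ x, t + R < ‖x‖ → u t x = 0)
    {t₁ ρ : ℝ} (ht₁ : t₁ ∈ timeInterval T) (hρ : t₁ + R < ρ) {χ : Space N → ℝ}
    (hχ : ContDiff ℝ ∞ χ) (hχc : HasCompactSupport χ)
    (hχ1 : ∀ x, ‖x‖ < ρ → χ =ᶠ[𝓝 x] fun _ => 1) {s t : ℝ} (hs : s ∈ Icc 0 t₁)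
    (ht : t ∈ Icc 0 t₁) (hst : s ≤ t) :
    ((1 + t) ^ (1 + Real.sqrt (delta μ ν) - r) * moment (fun x => χ x * 1) ut t -
      r * ((1 + t) ^ (Real.sqrt (delta μ ν) - r) * moment (fun x => χ x * 1) u t)) -
    ((1 + s) ^ (1 + Real.sqrt (delta μ ν) - r) * moment (fun x => χ x * 1) ut s -
      r * ((1 + s) ^ (Real.sqrt (delta μ ν) - r) * moment (fun x => χ x * 1) u s)) =
      ∫ τ in s..t, (1 + τ) ^ (1 + Real.sqrt (delta μ ν) - r) *
        sourceMoment p q (fun x => χ x * 1) u ut τ := by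
  have hchar := char_exponent_eq hδ hr
  set d := Real.sqrt (delta μ ν) with hd
  have hb : ContDiff ℝ ∞ fun x => χ x * 1 := hχ.mul contDiff_const
  have hbc : HasCompactSupport fun x => χ x * 1 := hχc.mul_right
  -- The weight 1 + d - r is chosen because (1 + d - r) - μ = r. Together with `char_exponent_eq`
  -- this makes the lower-order terms the exact derivative of r (1+t)^(d-r) U.
  obtain ⟨-, h1⟩ := h.moment_identity hsupp ht₁ hρ hχ hχc hχ1 contDiff_const (κ := 0)
    (fun x => by rw [coordLaplacian_const, zero_mul]) (1 + d - r) hs ht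
  set U := moment (fun x => χ x * 1) u with hU
  set V := moment (fun x => χ x * 1) ut with hV
  have hsub := Icc_subset_timeInterval ht₁
  have hst' : Icc s t ⊆ Icc 0 t₁ := Icc_subset_Icc hs.1 ht.2
  have hUd : ∀ τ ∈ Icc 0 t₁, HasDerivWithinAt U (V τ) (Icc 0 t₁) τ := fun τ hτ =>
    h.hasDerivWithinAt_moment ht₁ hb hbc hτ
  have hVc : ContinuousOn V (Icc 0 t₁) :=
    (continuousOn_pairing hb.continuous hbc h.continuousOn_ut).mono hsub
  have hUc : ContinuousOn U (Icc 0 t₁) := fun τ hτ => (hUd τ hτ).continuousWithinAt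
  have hFTC : ∫ τ in s..t, r * ((d - r) * (1 + τ) ^ (d - r - 1) * U τ + (1 + τ) ^ (d - r) * V τ) =
      r * ((1 + t) ^ (d - r) * U t) - r * ((1 + s) ^ (d - r) * U s) := by
    refine intervalIntegral.integral_eq_sub_of_hasDerivAt_of_le hst
      (f := fun τ => r * ((1 + τ) ^ (d - r) * U τ)) ?_ (fun τ hτ => ?_) ?_
    · exact (continuousOn_const.mul ((continuousOn_one_add_rpow _ _).mul hUc)).mono hst'
    · have hτ' := hst' (Ioo_subset_Icc_self hτ)
      have hda : HasDerivAt U (V τ) τ := (hUd τ hτ').hasDerivAt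
        (Icc_mem_nhds (lt_of_le_of_lt hs.1 hτ.1) (lt_of_lt_of_le hτ.2 ht.2))
      exact ((hasDerivAt_one_add_rpow (d - r) hτ'.1).mul hda).const_mul r
    · refine ContinuousOn.intervalIntegrable ?_
      rw [uIcc_of_le hst]
      exact (continuousOn_const.mul (((continuousOn_const.mul (continuousOn_one_add_rpow _ _)).mul hUc).add
        ((continuousOn_one_add_rpow _ _).mul hVc))).mono hst'
  have hcongr : ∫ τ in s..t, ((1 + d - r - μ) * (1 + τ) ^ (1 + d - r - 1) * V τ +
        (0 * (1 + τ) ^ (1 + d - r) - ν ^ 2 * (1 + τ) ^ (1 + d - r - 2)) * U τ) =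
      ∫ τ in s..t, r * ((d - r) * (1 + τ) ^ (d - r - 1) * U τ + (1 + τ) ^ (d - r) * V τ) := by
    refine intervalIntegral.integral_congr fun τ _ => ?_
    have e1 : 1 + d - r - μ = r := by rw [hr]; ring
    have e2 : 1 + d - r - 1 = d - r := by ring
    have e3 : 1 + d - r - 2 = d - r - 1 := by ring
    rw [e1, e2, e3, zero_mul, zero_sub, ← neg_mul, ← hchar]
    ring
  rw [hcongr, hFTC] at h1
  linarith

end WaveBlowup

/-! ### Conclusion: the lifespan bound. -/

open WaveBlowup
theorem theorem2p1 (N : ℕ) (hN : 1 ≤ N) (R μ ν p q : ℝ) (hR : 0 < R)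
    (hμ : 0 ≤ μ) (hNμ : 1 < (N : ℝ) + μ) (hδ : 0 ≤ delta μ ν)
    (hp : 1 < p) (hq : 1 < q)
    (hpG : pG (N + μ) < p) (hqS : qS (N + μ) < q) (hlam : lam p q (N + μ) < 4)
    (f g : Space N → ℝ) (hf : MemHOne f) (hg : MemLp g 2 volume)
    (hf_nonneg : ∀ᵐ x, 0 ≤ f x) (hg_nonneg : ∀ᵐ x, 0 ≤ g x)
    (hf_supp : ∀ᵐ x, R ≤ ‖x‖ → f x = 0) (hg_supp : ∀ᵐ x, R ≤ ‖x‖ → g x = 0)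
    (hfg_ne : ¬ ((∀ᵐ x, f x = 0) ∧ (∀ᵐ x, g x = 0)))
    (hfg_pos : ∀ᵐ x, (f x ≠ 0 ∨ g x ≠ 0) →
      0 < (μ - 1 - Real.sqrt (delta μ ν)) / 2 * f x + g x) :
    ∃ ε₀ : ℝ, 0 < ε₀ ∧ ∃ C : ℝ, 0 < C ∧
      ∀ ε : ℝ, 0 < ε → ε ≤ ε₀ →
        ∀ (T : EReal) (u ut : ℝ → LTwo N) (Du : ℝ → LTwoVec N),
          IsEnergySolution μ ν p q ε f g T u ut Du →
          (∀ t ∈ timeInterval T, ∀ᵐ x, t + R < ‖x‖ → u t x = 0) →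
          T ≤ ((C * ε ^ (-(2 * p * (q - 1) / (4 - lam p q (N + μ)))) : ℝ) : EReal) := by
  set d : ℝ := Real.sqrt (delta μ ν) with hd
  set r : ℝ := (1 - μ + d) / 2 with hr
  obtain ⟨c₁, hc₁, hsource₁⟩ := exists_sourceMoment_ge_rpow (ν := ν) hN hR hμ hp hq hf.1 hg hf_nonneg
    hg_nonneg hf_supp hg_supp hfg_ne
  obtain ⟨c₂, hc₂, hsource₂⟩ := exists_sourceMoment_ge_moment (N := N) (μ := μ) (ν := ν) (f := f)
    (g := g) hR hp hq
  set σ : ℝ := (N : ℝ) - 1 - ((N : ℝ) - 1 + μ) * p / 2 with hσ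
  set γ : ℝ := r * q - (N : ℝ) * (q - 1) with hγ
  obtain ⟨L, hL, hblow⟩ := exists_blowup_bound r d σ γ hq hc₁ hc₂
  set Λ : ℝ := 4 - lam p q (N + μ) with hΛ
  have hΛ0 : 0 < Λ := by rw [hΛ]; linarith
  -- The second entry ensures B^(Λ/2) ≥ L, contradicting the blow-up bound. The first ensures S ≥ 2,
  -- so that [S/2, 2S] lies in the range s ≥ 1 of the source bounds.
  set B : ℝ := max 2 (L ^ (2 / Λ)) with hB
  have hB2 : 2 ≤ B := le_max_left _ _
  have hBL : L ≤ B ^ (Λ / 2) := by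
    calc L = (L ^ (2 / Λ)) ^ (Λ / 2) := by
          rw [← Real.rpow_mul hL.le]
          have : 2 / Λ * (Λ / 2) = 1 := by field_simp
          rw [this, Real.rpow_one]
      _ ≤ _ := Real.rpow_le_rpow (by positivity) (le_max_right _ _) (by positivity)
  refine ⟨1, one_pos, 2 * B, by positivity, ?_⟩
  intro ε hε hε1 T u ut Du h hsupp
  by_contra! hT
  set κ : ℝ := 2 * p * (q - 1) / Λ with hκ
  have hq1 : 0 < q - 1 := by linarith
  have hp0 : 0 < p := by linarith
  have hκ0 : 0 < κ := by positivity
  -- If the lifespan bound fails, the solution lives beyond 2S. The exponent κ makes ε^(p(q-1))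
  -- S^(Λ/2) independent of ε.
  set S : ℝ := B * ε ^ (-κ) with hS
  have hεκ : 1 ≤ ε ^ (-κ) := Real.one_le_rpow_of_pos_of_le_one_of_nonpos hε hε1 (by linarith)
  have hS2 : 2 ≤ S := by
    rw [hS]; nlinarith
  have ht₁ : 2 * S ∈ timeInterval T := ⟨by linarith, by
    have : 2 * S = 2 * B * ε ^ (-κ) := by rw [hS]; ring
    rw [this]; exact hT⟩
  obtain ⟨χ, hχ, hχc, hχ0, hχ1, hχz⟩ := exists_space_cutoff N (ρ := 2 * S + R + 1) (by linarith)
  have hρ : 2 * S + R < 2 * S + R + 1 := by linarith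
  have hb : ContDiff ℝ ∞ fun x => χ x * 1 := hχ.mul contDiff_const
  have hbc : HasCompactSupport fun x => χ x * 1 := hχc.mul_right
  set U : ℝ → ℝ := moment (fun x => χ x * 1) u with hU
  set V : ℝ → ℝ := moment (fun x => χ x * 1) ut with hV
  set n : ℝ → ℝ := sourceMoment p q (fun x => χ x * 1) u ut with hn
  set H : ℝ → ℝ := fun t => (1 + t) ^ (-r) * U t with hH
  set Y : ℝ → ℝ := fun t => (1 + t) ^ (1 + d - r) * V t - r * ((1 + t) ^ (d - r) * U t) with hY
  have hn0 : ∀ s, 0 ≤ n s := fun s => sourceMoment_nonneg p q (fun x => by simpa using hχ0 x) u ut s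
  have hYid : ∀ s ∈ Icc 0 (2 * S), ∀ t ∈ Icc 0 (2 * S), s ≤ t →
      Y t - Y s = ∫ τ in s..t, (1 + τ) ^ (1 + d - r) * n τ := fun s hs t ht hst =>
    h.mean_identity hδ hr hsupp ht₁ hρ hχ hχc hχ1 hs ht hst
  have hYint : ∀ s ∈ Icc 0 (2 * S), ∀ t ∈ Icc 0 (2 * S),
      IntervalIntegrable (fun τ => (1 + τ) ^ (1 + d - r) * n τ) volume s t := fun s hs t ht =>
    (h.moment_identity hsupp ht₁ hρ hχ hχc hχ1 contDiff_const (κ := 0)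
      (fun x => by rw [coordLaplacian_const, zero_mul]) (1 + d - r) hs ht).1
  have hHd : ∀ t ∈ Icc 0 (2 * S),
      HasDerivWithinAt H (Y t * (1 + t) ^ (-(1 + d))) (Icc 0 (2 * S)) t := by
    intro t ht
    have ht0 : 0 < 1 + t := by linarith [ht.1]
    have h1 := (hasDerivAt_one_add_rpow (-r) ht.1).hasDerivWithinAt.mul
      (h.hasDerivWithinAt_moment ht₁ hb hbc ht)
    refine h1.congr_deriv ?_
    have e1 : (1 + t) ^ (1 + d - r) * (1 + t) ^ (-(1 + d)) = (1 + t) ^ (-r) := by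
      rw [← Real.rpow_add ht0]; ring_nf
    have e2 : (1 + t) ^ (d - r) * (1 + t) ^ (-(1 + d)) = (1 + t) ^ (-r - 1) := by
      rw [← Real.rpow_add ht0]; ring_nf
    simp only [hY]
    rw [← e1, ← e2]
    ring
  have h0mem : (0 : ℝ) ∈ Icc 0 (2 * S) := ⟨le_rfl, by linarith⟩
  have hIU : U 0 = ε * ∫ x in Metric.closedBall 0 R, f x * (fun _ => (1 : ℝ)) x :=
    moment_initial (φ := fun _ => 1) (by linarith) hχ1 h.initial_u hf_supp
  have hIV : V 0 = ε * ∫ x in Metric.closedBall 0 R, g x * (fun _ => (1 : ℝ)) x :=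
    moment_initial (φ := fun _ => 1) (by linarith) hχ1 h.initial_ut hg_supp
  have hU0 : 0 ≤ U 0 := by
    rw [hIU]
    refine mul_nonneg hε.le (setIntegral_nonneg_of_ae ?_)
    filter_upwards [hf_nonneg] with x hx
    simpa using hx
  -- Y(0) is ε times the integral of g - r f, and the coefficient of f in the sign condition on the
  -- data is exactly -r.
  have hY0 : 0 ≤ Y 0 := by
    have hi1 := integrableOn_mul_of_memLp hf.1 (continuous_const (y := (1 : ℝ))) R
    have hi2 := integrableOn_mul_of_memLp hg (continuous_const (y := (1 : ℝ))) R
    have : Y 0 = ε * ∫ x in Metric.closedBall (0 : Space N) R, (g x * 1 - r * (f x * 1)) := by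
      rw [integral_sub hi2 (hi1.const_mul r), integral_const_mul]
      simp only [hY, add_zero, Real.one_rpow, one_mul]
      rw [hIU, hIV]
      ring
    rw [this]
    refine mul_nonneg hε.le (setIntegral_nonneg_of_ae ?_)
    filter_upwards [hfg_pos] with x hx
    simp only [Pi.zero_apply]
    by_cases hz : f x ≠ 0 ∨ g x ≠ 0
    · have h1 := hx hz
      have h2 : (μ - 1 - d) / 2 = -r := by rw [hr]; ring
      rw [h2] at h1
      linarith
    · push Not at hz
      rw [hz.1, hz.2]; simp
  have hYnn : ∀ t ∈ Icc 0 (2 * S), 0 ≤ Y t := by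
    intro t ht
    have h1 := hYid 0 h0mem t ht ht.1
    have h2 : 0 ≤ ∫ τ in (0 : ℝ)..t, (1 + τ) ^ (1 + d - r) * n τ :=
      intervalIntegral.integral_nonneg ht.1 fun τ hτ =>
        mul_nonneg (Real.rpow_nonneg (by linarith [hτ.1]) _) (hn0 τ)
    linarith
  have hHmono : MonotoneOn H (Icc 0 (2 * S)) :=
    monotoneOn_Icc_of_hasDerivWithinAt_nonneg hHd fun t ht =>
      mul_nonneg (hYnn t (Ioo_subset_Icc_self ht)) (Real.rpow_nonneg (by linarith [ht.1]) _)
  have hH0 : 0 ≤ H 0 := by simpa [hH] using hU0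
  have hHnn : ∀ t ∈ Icc 0 (2 * S), 0 ≤ H t := fun t ht => hH0.trans (hHmono h0mem ht ht.1)
  have hsubI : Icc (S / 2) (2 * S) ⊆ Icc 0 (2 * S) := Icc_subset_Icc_left (by linarith)
  have hsub1 : Icc (S / 2) (2 * S) ⊆ Icc 1 (2 * S) := Icc_subset_Icc_left (by linarith)
  have hmemL : S / 2 ∈ Icc 0 (2 * S) := ⟨by linarith, by linarith⟩
  have hfin := hblow S (ε ^ p) H Y n hS2 (by positivity)
    (fun t ht => (hHd t (hsubI ht)).mono hsubI) (hHnn _ hmemL) (hYnn _ hmemL)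
    (fun a ha b hb => ⟨hYint a (hsubI ha) b (hsubI hb), by
      rcases le_total a b with hab | hab
      · exact hYid a (hsubI ha) b (hsubI hb) hab
      · have := hYid b (hsubI hb) a (hsubI ha) hab
        rw [intervalIntegral.integral_symm, ← this]; ring⟩)
    hn0
    (ae_restrict_of_ae_restrict_of_subset hsub1 (hsource₁ ε T u ut Du hε h hsupp (2 * S) _ χ
      (by linarith) ht₁ hρ hχ hχc hχ0 hχ1 hχz))
    (by
      filter_upwards [ae_restrict_of_ae_restrict_of_subset hsub1 (hsource₂ ε T u ut Du h hsupp (2 * S)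
        _ χ ht₁ hρ hχ hχ0 hχ1 hχz), ae_restrict_mem measurableSet_Icc] with s hs hs'
      refine le_trans (le_of_eq ?_) hs
      have hs0 : 0 < 1 + s := by linarith [hs'.1]
      have hHs := hHnn s (hsubI hs')
      -- Rewriting |U|^q through H, which is nonnegative, turns the weight (1+s)^(-N(q-1)) into
      -- (1+s)^γ.
      have e1 : U s = (1 + s) ^ r * H s := by
        simp only [hH]
        rw [← mul_assoc, ← Real.rpow_add hs0]; simp
      change _ = c₂ * ((1 + s) ^ (-((N : ℝ) * (q - 1))) * |U s| ^ q)
      rw [e1, abs_of_nonneg (by positivity), Real.mul_rpow (by positivity) hHs,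
        ← Real.rpow_mul hs0.le, ← mul_assoc ((1 + s) ^ (-((N : ℝ) * (q - 1)))), ← Real.rpow_add hs0, hγ]
      ring_nf)
  -- The terms in r add up to -(q-1)r + rq - r = 0, so ν disappears and μ enters only through N + μ.
  have hexp : (q - 1) * (σ + 2 - r) + γ - r + 2 = Λ / 2 := by
    rw [hσ, hγ, hΛ, lam]; ring
  rw [hexp] at hfin
  have hcalc : (ε ^ p) ^ (q - 1) * S ^ (Λ / 2) = B ^ (Λ / 2) := by
    rw [hS, Real.mul_rpow (by positivity) (by positivity), ← Real.rpow_mul hε.le, ← Real.rpow_mul hε.le]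
    have e1 : -κ * (Λ / 2) = -(p * (q - 1)) := by rw [hκ]; field_simp
    rw [e1, mul_left_comm, ← Real.rpow_add hε]
    simp
  rw [hcalc] at hfin
  linarith
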